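/- Let $R$ be an associative unital ring, not necessarily commutative. By an $R$-complex we mean a ($\mathbb{Z}$-graded, possibly unbounded) chain complex of left $R$-modules; $R^{\mathrm{op}}$-complexes are chain complexes of right $R$-modules. An $R$-complex $F$ is called \emph{semi-flat} if every $F_i$ is a flat $R$-module and the total tensor product complex $A\otimes_R F$ is acyclic for every acyclic $R^{\mathrm{op}}$-complex $A$. An $R$-complex $L$ is called \emph{semi-free} if its underlying graded module has a basis $E$ consisting of homogeneous elements that is a disjoint union $E=\biguplus_{n\ge 0}E^n$ such that $\partial(E^0)=0$ and $\partial(E^n)$ is contained in the $R$-submodule generated by $E^0\cup\dots\cup E^{n-1}$ for every $n\ge 1$. An object $A$ of the category $\mathcal{C}(R)$ of $R$-complexes is \emph{finitely presented} if $\mathcal{C}(R)(A,-)$ preserves filtered colimits. A short exact sequence $0\to M'\to M\to M''\to 0$ of $R$-complexes is \emph{pure} if $$0\to \mathcal{C}(R)(A,M')\to \mathcal{C}(R)(A,M)\to \mathcal{C}(R)(A,M'')\to 0$$ is exact for every finitely presented object $A$ of $\mathcal{C}(R)$; in this case $M\to M''$ is called a \emph{pure epimorphism}. \textbf{Proposition.}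 For an $R$-complex $F$ the following conditions are equivalent. \begin{enumerate} \item[(i)] $F$ is semi-flat. \item[(ii)] Every surjective quasi-isomorphism of $R$-complexes $M\to F$ is a pure epimorphism. \item[(iii)] There exist a semi-free $R$-complex $L$ and a quasi-isomorphism $L\to F$ which is also a pure epimorphism. \end{enumerate} -/

import Mathlib

open CategoryTheory CategoryTheory.Limits Opposite TensorProduct

universe v u

noncomputable section

namespace SemiFlat

/-! ### The tensor product over a not necessarily commutative ring -/

section Tensor

variable (R : Type*) [Ring R]

/-- The subgroup of `M ⊗[ℤ] N` generated by the elements `(m r) ⊗ n - m ⊗ (r n)`; here `M` is a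
right `R`-module (a left module over the opposite ring) and `N` is a left `R`-module. -/
def tensorRelations (M N : Type*) [AddCommGroup M] [Module Rᵐᵒᵖ M] [AddCommGroup N] [Module R N] :
    AddSubgroup (M ⊗[ℤ] N) :=
  AddSubgroup.closure {t | ∃ (m : M) (r : R) (n : N),
    t = (MulOpposite.op r • m) ⊗ₜ[ℤ] n - m ⊗ₜ[ℤ] (r • n)}

/-- The tensor product `M ⊗_R N` of a right and a left `R`-module, as an abelian group. -/
abbrev RingTensor (M N : Type*) [AddCommGroup M] [Module Rᵐᵒᵖ M] [AddCommGroup N] [Module R N] :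
    Type _ :=
  (M ⊗[ℤ] N) ⧸ tensorRelations R M N

variable {R}
variable {M M' N N' : Type*} [AddCommGroup M] [Module Rᵐᵒᵖ M] [AddCommGroup N] [Module R N]
  [AddCommGroup M'] [Module Rᵐᵒᵖ M'] [AddCommGroup N'] [Module R N']

variable (R) in
/-- The class `m ⊗ n` in `M ⊗_R N`. -/
def ringTmul (m : M) (n : N) : RingTensor R M N :=
  QuotientAddGroup.mk (m ⊗ₜ[ℤ] n)

lemma ringTensor_hom_ext {A : Type*} [AddCommGroup A] {φ ψ : RingTensor R M N →+ A}
    (h : ∀ m n, φ (ringTmul R m n) = ψ (ringTmul R m n)) : φ = ψ := by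
  refine QuotientAddGroup.addMonoidHom_ext _ (AddMonoidHom.ext fun t => ?_)
  induction t using TensorProduct.induction_on with
  | zero => rw [map_zero, map_zero]
  | tmul m n => exact h m n
  | add x y hx hy => rw [map_add, map_add, hx, hy]

/-- The homomorphism `f ⊗_R g`, given by `m ⊗ n ↦ f m ⊗ g n`. -/
def ringTensorMap (f : M →ₗ[Rᵐᵒᵖ] M') (g : N →ₗ[R] N') :
    RingTensor R M N →+ RingTensor R M' N' :=
  QuotientAddGroup.map _ _
    (TensorProduct.map f.toAddMonoidHom.toIntLinearMap
      g.toAddMonoidHom.toIntLinearMap).toAddMonoidHom (by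
      refine (AddSubgroup.closure_le _).2 ?_
      rintro _ ⟨m, r, n, rfl⟩
      refine AddSubgroup.subset_closure ⟨f m, r, g n, ?_⟩
      rw [map_sub, ← map_smul f, ← map_smul g]
      rfl)

@[simp]
lemma ringTensorMap_tmul (f : M →ₗ[Rᵐᵒᵖ] M') (g : N →ₗ[R] N') (m : M) (n : N) :
    ringTensorMap f g (ringTmul R m n) = ringTmul R (f m) (g n) := rfl

end Tensor

/-- The bifunctor `(M, N) ↦ M ⊗_R N` from right and left `R`-modules to abelian groups. -/
def tensorBifunctor (R : Type u) [Ring R] :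
    ModuleCat.{v} Rᵐᵒᵖ ⥤ ModuleCat.{v} R ⥤ AddCommGrpCat.{v} where
  obj M :=
    { obj := fun N => AddCommGrpCat.of (RingTensor R M N)
      map := fun g => AddCommGrpCat.ofHom (ringTensorMap LinearMap.id g.hom)
      map_id := fun N => by
        ext : 1
        exact ringTensor_hom_ext fun m n => rfl
      map_comp := fun g g' => by
        ext : 1
        exact ringTensor_hom_ext fun m n => rfl }
  map f :=
    { app := fun N => AddCommGrpCat.ofHom (ringTensorMap f.hom LinearMap.id)
      naturality := fun N N' g => by
        ext : 1
        exact ringTensor_hom_ext fun m n => rfl }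
  map_id M := by
    ext N : 3
    exact ringTensor_hom_ext fun m n => rfl
  map_comp f f' := by
    ext N : 3
    exact ringTensor_hom_ext fun m n => rfl

instance tensorBifunctor_preservesZeroMorphisms (R : Type u) [Ring R] :
    (tensorBifunctor.{v} R).PreservesZeroMorphisms where
  map_zero M M' := by
    ext N : 3
    refine ringTensor_hom_ext fun m n => ?_
    change QuotientAddGroup.mk ((0 : M') ⊗ₜ[ℤ] n) = 0
    rw [TensorProduct.zero_tmul, QuotientAddGroup.mk_zero]

instance tensorBifunctor_obj_preservesZeroMorphisms (R : Type u) [Ring R]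
    (M : ModuleCat.{v} Rᵐᵒᵖ) : ((tensorBifunctor.{v} R).obj M).PreservesZeroMorphisms where
  map_zero N N' := by
    ext : 1
    refine ringTensor_hom_ext fun m n => ?_
    change QuotientAddGroup.mk (m ⊗ₜ[ℤ] (0 : N')) = 0
    rw [TensorProduct.tmul_zero, QuotientAddGroup.mk_zero]

/-! ### The total tensor product of complexes

Complexes are graded homologically by `ℤ`: the differential lowers the degree by one. -/

/-- The usual sign rule `∂(m ⊗ n) = ∂m ⊗ n + (-1)^p m ⊗ ∂n`, `p` the degree of `m`. -/
instance tensorSignsDownInt : (ComplexShape.down ℤ).TensorSigns where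
  ε' := MonoidHom.mk' (fun i : Multiplicative ℤ => Int.negOnePow i.toAdd)
    (fun i j => Int.negOnePow_add i.toAdd j.toAdd)
  rel_add p q r (hpq : q + 1 = p) := by
    change q + r + 1 = p + r
    lia
  add_rel p q r (hpq : q + 1 = p) := by
    change r + q + 1 = r + p
    lia
  ε'_succ p q hpq := by
    obtain rfl : q + 1 = p := hpq
    change Int.negOnePow q = - Int.negOnePow (q + 1)
    rw [Int.negOnePow_succ, neg_neg]

/-- The total tensor product complex `A ⊗_R F` of an `Rᵐᵒᵖ`-complex and an `R`-complex; in
degree `n` it is the direct sum of the groups `A_p ⊗_R F_q` with `p + q = n`. -/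
def tensorComplex {R : Type u} [Ring R] (A : ChainComplex (ModuleCat.{v} Rᵐᵒᵖ) ℤ)
    (F : ChainComplex (ModuleCat.{v} R) ℤ) : ChainComplex (AddCommGrpCat.{v}) ℤ :=
  HomologicalComplex.mapBifunctor A F (tensorBifunctor R) (ComplexShape.down ℤ)

/-! ### Semi-flat and semi-free complexes -/

/-- A left `R`-module `N` is flat if `- ⊗_R N` preserves injective homomorphisms. -/
def IsFlatModule {R : Type u} [Ring R] (N : ModuleCat.{v} R) : Prop :=
  ∀ (M M' : ModuleCat.{v} Rᵐᵒᵖ) (f : M ⟶ M'), Function.Injective f →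
    Function.Injective (((tensorBifunctor R).map f).app N)

/-- A complex `F` is semi-flat if it consists of flat modules and `- ⊗_R F` preserves acyclicity. -/
structure IsSemiFlat {R : Type u} [Ring R] (F : ChainComplex (ModuleCat.{v} R) ℤ) : Prop where
  flat (i : ℤ) : IsFlatModule (F.X i)
  acyclic (A : ChainComplex (ModuleCat.{v} Rᵐᵒᵖ) ℤ) : A.Acyclic → (tensorComplex A F).Acyclic

/-- A complex `L` is semi-free if it has a graded basis `E` (the elements of degree `i` are
`b i e` for `e : E i`) and a decomposition of `E` into disjoint sets `E^n`, `n ≥ 0` (`E^n` is the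
set of elements of level `n`) such that the differential maps `E^n` into the submodule generated by
`E^0, …, E^(n-1)`; for `n = 0` this says that `E^0` consists of cycles. -/
def IsSemiFree {R : Type u} [Ring R] (L : ChainComplex (ModuleCat.{v} R) ℤ) : Prop :=
  ∃ (E : ℤ → Type v) (b : ∀ i, Module.Basis (E i) R (L.X i)) (level : ∀ i, E i → ℕ),
    ∀ (i : ℤ) (e : E i), L.d i (i - 1) (b i e) ∈
      Submodule.span R (b (i - 1) '' {e' | level (i - 1) e' < level i e})

/-! ### Purity -/

/-- A short exact sequence `0 → M' → M → M'' → 0` is pure if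
`0 → Hom(A, M') → Hom(A, M) → Hom(A, M'') → 0` is exact for every finitely presented object `A`,
that is, for every `A` such that `Hom(A, -)` preserves filtered colimits. -/
structure IsPureExact {C : Type u} [Category.{v} C] [Preadditive C] (S : ShortComplex C) :
    Prop where
  shortExact : S.ShortExact
  hom_shortExact (A : C) : IsFinitelyPresentable.{v} A →
    (S.map (preadditiveCoyoneda.obj (op A))).ShortExact

/-- A pure epimorphism is the second map `M → M''` of a pure exact sequence. -/
def IsPureEpi {C : Type u} [Category.{v} C] [Preadditive C] {X Y : C} (α : X ⟶ Y) : Prop :=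
  ∃ (K : C) (ι : K ⟶ X) (w : ι ≫ α = 0), IsPureExact (ShortComplex.mk ι α w)

end SemiFlat

end

noncomputable section

namespace SemiFlat

/-! ### Characters with values in the circle `ℝ / ℤ` -/

section Characters

variable {M N : Type*} [AddCommGroup M] [AddCommGroup N]

/-! Everything is dualized into the circle T = ℝ/ℤ, which is divisible, so that characters extend
and detect exactness, and compact, so that ultrafilter limits exist. The pivot is `HasDualRetraction
π`: the dual π* : Hom(F, T) → Hom(M, T) has a left inverse σ that is Rᵐᵒᵖ-linear and commutes with
the differentials. For degreewise surjective π this is equivalent to purity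
(`isPureEpi_iff_hasDualRetraction`), by way of the lifting of finite sets of relations: given σ, an
unsolvable finite system of relations would be separated by a character, which σ carries to a
relation that already holds in F; conversely σ is an ultrafilter limit of sections of π that respect
more and more relations.

Semi-flat implies pure (`IsSemiFlat.hasDualRetraction`): flatness of F_i makes Hom(F_i, T)
injective, so π* has a retraction in each degree. Its failure to commute with the differentials
factors through the dual of the acyclic kernel K, and is null-homotopic because characters of K* ⊗ F
are families of maps K* → F*. The homotopy corrects the retraction.

For the converse (`IsSemiFree.isSemiFlat_of_hasDualRetraction`), flatness and acyclicity of A ⊗ F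
become extension problems for balanced pairings A × F → T. These are pulled back to the semi-free L,
solved on a basis by recursion on the level, and brought back to F by σ. Finally, `Cell.resolution`
is a surjective semi-free resolution, which links the second condition to the third. -/

lemma exists_character_ne_zero {m : M} (hm : m ≠ 0) : ∃ χ : M →+ UnitAddCircle, χ m ≠ 0 := by
  obtain ⟨c, hc⟩ := CharacterModule.exists_character_apply_ne_zero_of_ne_zero hm
  -- Characters in ℚ/ℤ already separate points, and ℚ/ℤ embeds into ℝ/ℤ; the larger group is used
  -- for its compactness.
  let j : AddCircle (1 : ℚ) →+ UnitAddCircle :=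
    QuotientAddGroup.map _ _ (Rat.castHom ℝ).toAddMonoidHom (by
      rintro _ ⟨n, rfl⟩
      exact ⟨n, by simp⟩)
  have hj : Function.Injective j := by
    rw [injective_iff_map_eq_zero]
    intro a
    induction a using QuotientAddGroup.induction_on with
    | H q =>
      intro h
      obtain ⟨n, hn⟩ := (AddCircle.coe_eq_zero_iff (1 : ℝ) (x := (q : ℝ))).1 h
      refine (AddCircle.coe_eq_zero_iff (1 : ℚ)).2 ⟨n, ?_⟩
      have : ((n : ℚ) : ℝ) = q := by simpa using hn
      simpa using Rat.cast_injective this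
  exact ⟨j.comp c, fun h => hc (hj (h.trans (map_zero j).symm))⟩

lemma exists_character_extension (f : M →+ N) (hf : Function.Injective f)
    (χ : M →+ UnitAddCircle) : ∃ χ' : N →+ UnitAddCircle, ∀ m, χ' (f m) = χ m := by
  obtain ⟨h, hh⟩ :=
    (Module.Baer.of_divisible UnitAddCircle).extension_property_addMonoidHom f hf χ
  exact ⟨h, fun m => DFunLike.congr_fun hh m⟩

lemma exists_character_of_notMem {H : AddSubgroup M} {m : M} (hm : m ∉ H) :
    ∃ χ : M →+ UnitAddCircle, (∀ h ∈ H, χ h = 0) ∧ χ m ≠ 0 := by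
  obtain ⟨χ, hχ⟩ := exists_character_ne_zero (M := M ⧸ H) (m := QuotientAddGroup.mk m)
    (fun h => hm ((QuotientAddGroup.eq_zero_iff m).1 h))
  refine ⟨χ.comp (QuotientAddGroup.mk' H), fun h hh => ?_, hχ⟩
  have : (QuotientAddGroup.mk' H) h = 0 := (QuotientAddGroup.eq_zero_iff h).2 hh
  rw [AddMonoidHom.comp_apply, this, map_zero]

lemma injective_iff_character_extension (f : M →+ N) :
    Function.Injective f ↔
      ∀ χ : M →+ UnitAddCircle, ∃ χ' : N →+ UnitAddCircle, ∀ m, χ' (f m) = χ m := by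
  refine ⟨exists_character_extension f, fun h => (injective_iff_map_eq_zero f).2 fun m hm => ?_⟩
  by_contra hm'
  obtain ⟨χ, hχ⟩ := exists_character_ne_zero hm'
  obtain ⟨χ', h'⟩ := h χ
  exact hχ (by rw [← h', hm, map_zero])

/-- A character of `M` vanishing on the kernel of `f` factors through `f`. -/
lemma exists_character_factorization (f : M →+ N) (χ : M →+ UnitAddCircle)
    (h : ∀ m, f m = 0 → χ m = 0) : ∃ χ' : N →+ UnitAddCircle, ∀ m, χ' (f m) = χ m := by
  obtain ⟨χ', hχ'⟩ := exists_character_extension (QuotientAddGroup.kerLift f)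
    (QuotientAddGroup.kerLift_injective f) (QuotientAddGroup.lift f.ker χ h)
  exact ⟨χ', fun m => hχ' (QuotientAddGroup.mk m)⟩

/-- Exactness is detected by characters. -/
lemma exact_iff_character {P : Type*} [AddCommGroup P] (f : M →+ N) (g : N →+ P) :
    (∀ n, g n = 0 → ∃ m, f m = n) ↔
      ∀ χ : N →+ UnitAddCircle, (∀ m, χ (f m) = 0) →
        ∃ χ' : P →+ UnitAddCircle, ∀ n, χ' (g n) = χ n := by
  refine ⟨fun h χ hχ => exists_character_factorization g χ fun n hn => ?_, fun h n hn => ?_⟩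
  · obtain ⟨m, rfl⟩ := h n hn
    exact hχ m
  · by_contra hn'
    obtain ⟨χ, hχ, hχn⟩ := exists_character_of_notMem (H := f.range) (m := n)
      (fun ⟨m, hm⟩ => hn' ⟨m, hm⟩)
    obtain ⟨χ', h'⟩ := h χ fun m => hχ _ ⟨m, rfl⟩
    exact hχn (by rw [← h', hn, map_zero])

end Characters

/-! ### Balanced pairings -/

section Pairings

variable {R : Type*} [Ring R] {M M' N N' : Type*} [AddCommGroup M] [Module Rᵐᵒᵖ M]
  [AddCommGroup M'] [Module Rᵐᵒᵖ M'] [AddCommGroup N] [Module R N] [AddCommGroup N'] [Module R N']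

/-- The character group of a left `R`-module is a right `R`-module. -/
instance characterModule : Module Rᵐᵒᵖ (N →+ UnitAddCircle) where
  smul r χ := χ.comp (DistribSMul.toAddMonoidHom N r.unop)
  one_smul χ := AddMonoidHom.ext fun n => congrArg χ (one_smul R n)
  mul_smul r s χ := AddMonoidHom.ext fun n => congrArg χ (mul_smul s.unop r.unop n)
  smul_zero _ := rfl
  smul_add _ _ _ := rfl
  add_smul r s χ := AddMonoidHom.ext fun n =>
    (congrArg χ (add_smul r.unop s.unop n)).trans (map_add χ _ _)
  zero_smul χ := AddMonoidHom.ext fun n => (congrArg χ (zero_smul R n)).trans (map_zero χ)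

@[simp]
lemma op_smul_character_apply (r : Rᵐᵒᵖ) (χ : N →+ UnitAddCircle) (n : N) :
    (r • χ) n = χ (r.unop • n) := rfl

/-- The map induced on character groups by a linear map. -/
def characterMap (f : N →ₗ[R] N') : (N' →+ UnitAddCircle) →ₗ[Rᵐᵒᵖ] (N →+ UnitAddCircle) where
  toFun χ := χ.comp f.toAddMonoidHom
  map_add' _ _ := rfl
  map_smul' r χ := AddMonoidHom.ext fun n => congrArg χ (map_smul f r.unop n).symm

@[simp]
lemma characterMap_apply (f : N →ₗ[R] N') (χ : N' →+ UnitAddCircle) (n : N) :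
    characterMap f χ n = χ (f n) := rfl

/-- The character of `M ⊗_R N` given by a balanced pairing of `M` and `N`. -/
def pairingCharacter (h : M →ₗ[Rᵐᵒᵖ] (N →+ UnitAddCircle)) :
    RingTensor R M N →+ UnitAddCircle :=
  QuotientAddGroup.lift _
    (TensorProduct.liftAddHom h.toAddMonoidHom (fun r m n => by
      simp)) (by
      refine (AddSubgroup.closure_le _).2 ?_
      rintro _ ⟨m, r, n, rfl⟩
      simp)

lemma smul_ringTmul (r : Rᵐᵒᵖ) (m : M) (n : N) :
    ringTmul R (r • m) n = ringTmul R m (r.unop • n) := by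
  refine QuotientAddGroup.eq.2 ?_
  rw [← AddSubgroup.neg_mem_iff]
  refine AddSubgroup.subset_closure ⟨m, r.unop, n, ?_⟩
  simp only [MulOpposite.op_unop]
  abel

variable (R M N) in
/-- The canonical biadditive map to the tensor product. -/
def ringTmulHom : M →+ N →+ RingTensor R M N :=
  AddMonoidHom.mk' (fun m => AddMonoidHom.mk' (fun n => ringTmul R m n) fun n n' =>
      congrArg QuotientAddGroup.mk (TensorProduct.tmul_add m n n'))
    fun m m' => AddMonoidHom.ext fun n =>
      congrArg QuotientAddGroup.mk (TensorProduct.add_tmul m m' n)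

/-- The balanced pairing given by a character of `M ⊗_R N`. -/
def characterPairing (χ : RingTensor R M N →+ UnitAddCircle) :
    M →ₗ[Rᵐᵒᵖ] (N →+ UnitAddCircle) where
  toFun m := χ.comp (ringTmulHom R M N m)
  map_add' m m' := by rw [map_add, AddMonoidHom.comp_add]
  map_smul' r m := AddMonoidHom.ext fun n => congrArg χ (smul_ringTmul r m n)

end Pairings

/-- By the tensor-hom adjunction a character of M ⊗ N is a linear map from M to the dual of N. Thus
N is flat exactly when its dual extends maps along injections, that is, when the dual is injective.
-/
lemma isFlatModule_iff {R : Type u} [Ring R] (N : ModuleCat.{v} R) :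
    IsFlatModule N ↔ ∀ (M M' : ModuleCat.{v} Rᵐᵒᵖ) (f : M ⟶ M'), Function.Injective f →
      ∀ h : M →ₗ[Rᵐᵒᵖ] (N →+ UnitAddCircle), ∃ h' : M' →ₗ[Rᵐᵒᵖ] (N →+ UnitAddCircle),
        ∀ m, h' (f m) = h m := by
  refine forall₄_congr fun M M' f hf => ?_
  refine (injective_iff_character_extension
    (ringTensorMap f.hom (LinearMap.id : N →ₗ[R] N))).trans ⟨fun H h => ?_, fun H χ => ?_⟩
  · obtain ⟨χ', hχ'⟩ := H (pairingCharacter h)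
    exact ⟨characterPairing χ', fun m => AddMonoidHom.ext fun n => hχ' (ringTmul R m n)⟩
  · obtain ⟨h', hh'⟩ := H (characterPairing χ)
    refine ⟨pairingCharacter h', fun t => ?_⟩
    exact DFunLike.congr_fun (ringTensor_hom_ext
      (φ := (pairingCharacter h').comp (ringTensorMap f.hom LinearMap.id)) (ψ := χ)
      fun m n => DFunLike.congr_fun (hh' m) n) t

/-! ### Acyclicity -/

lemma acyclic_iff_exact {R : Type u} [Ring R] (K : ChainComplex (ModuleCat.{v} R) ℤ) :
    K.Acyclic ↔ ∀ i j k : ℤ, j + 1 = i → k + 1 = j → ∀ x : K.X j, K.d j k x = 0 →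
      ∃ y : K.X i, K.d i j y = x := by
  refine ⟨fun h i j k hi hj x hx => ?_, fun h j => ?_⟩
  · have := (HomologicalComplex.exactAt_iff' K i j k (by subst hi; simp)
      (by subst hj; simp)).1 (h j)
    exact (ShortComplex.moduleCat_exact_iff _).1 this x hx
  · rw [HomologicalComplex.exactAt_iff' K (j + 1) j (j - 1) (by simp) (by simp),
      ShortComplex.moduleCat_exact_iff]
    exact h _ _ _ rfl (by simp)

lemma acyclic_iff_character (K : ChainComplex AddCommGrpCat.{v} ℤ) :
    K.Acyclic ↔ ∀ j : ℤ, ∀ χ : K.X j →+ UnitAddCircle,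
      (∀ x, χ (K.d (j + 1) j x) = 0) →
        ∃ χ' : K.X (j - 1) →+ UnitAddCircle, ∀ x, χ' (K.d j (j - 1) x) = χ x := by
  refine forall_congr' fun j => ?_
  rw [HomologicalComplex.exactAt_iff' K (j + 1) j (j - 1) (by simp) (by simp),
    ShortComplex.ab_exact_iff]
  exact exact_iff_character (K.d (j + 1) j).hom (K.d j (j - 1)).hom

/-- The character of `(A ⊗_R F)_n` given by a family of balanced pairings. -/
def tensorComplexCharacter {R : Type u} [Ring R] {A : ChainComplex (ModuleCat.{v} Rᵐᵒᵖ) ℤ}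
    {F : ChainComplex (ModuleCat.{v} R) ℤ}
    (h : ∀ p q : ℤ, A.X p →ₗ[Rᵐᵒᵖ] (F.X q →+ UnitAddCircle)) (n : ℤ) :
    (tensorComplex A F).X n →+ UnitAddCircle :=
  -- The circle is lifted to the universe of the complexes, so that the universal property of the
  -- coproduct applies to it.
  AddEquiv.ulift.toAddMonoidHom.comp
    (HomologicalComplex.mapBifunctorDesc (K₁ := A) (K₂ := F) (F := tensorBifunctor R)
      (c := ComplexShape.down ℤ) (j := n) (A := AddCommGrpCat.of (ULift.{v} UnitAddCircle))
      fun p q _ => AddCommGrpCat.ofHom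
        (AddEquiv.ulift.symm.toAddMonoidHom.comp (pairingCharacter (h p q)))).hom

/-- The class of `a ⊗ y` in `(A ⊗_R F)_n`. -/
def tensorComplexMk {R : Type u} [Ring R] {A : ChainComplex (ModuleCat.{v} Rᵐᵒᵖ) ℤ}
    {F : ChainComplex (ModuleCat.{v} R) ℤ} {p q n : ℤ} (hn : p + q = n) (a : A.X p) (y : F.X q) :
    (tensorComplex A F).X n :=
  (HomologicalComplex.ιMapBifunctor A F (tensorBifunctor R) (ComplexShape.down ℤ) p q n hn).hom
    (ringTmul R a y)

section

variable {R : Type u} [Ring R] {A : ChainComplex (ModuleCat.{v} Rᵐᵒᵖ) ℤ}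
    {F : ChainComplex (ModuleCat.{v} R) ℤ}

lemma tensorComplexCharacter_mk (h : ∀ p q : ℤ, A.X p →ₗ[Rᵐᵒᵖ] (F.X q →+ UnitAddCircle))
    {p q n : ℤ} (hn : p + q = n) (a : A.X p) (y : F.X q) :
    tensorComplexCharacter h n (tensorComplexMk hn a y) = h p q a y := by
  have := ConcreteCategory.congr_hom (HomologicalComplex.ι_mapBifunctorDesc (K₁ := A) (K₂ := F)
    (F := tensorBifunctor R)
    (c := ComplexShape.down ℤ) (j := n) (A := AddCommGrpCat.of (ULift.{v} UnitAddCircle))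
    (fun p q _ => AddCommGrpCat.ofHom
      (AddEquiv.ulift.symm.toAddMonoidHom.comp (pairingCharacter (h p q)))) p q hn)
    (ringTmul R a y)
  exact congrArg ULift.down this

lemma tensorComplex_character_ext {n : ℤ} {χ χ' : (tensorComplex A F).X n →+ UnitAddCircle}
    (h : ∀ p q (hn : p + q = n) (a : A.X p) (y : F.X q),
      χ (tensorComplexMk hn a y) = χ' (tensorComplexMk hn a y)) : χ = χ' := by
  have : AddCommGrpCat.ofHom (AddEquiv.ulift.symm.toAddMonoidHom.comp χ) =
      (AddCommGrpCat.ofHom (AddEquiv.ulift.symm.toAddMonoidHom.comp χ') :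
        (tensorComplex A F).X n ⟶ AddCommGrpCat.of (ULift.{v} UnitAddCircle)) := by
    refine HomologicalComplex.mapBifunctor.hom_ext fun p q hn => ?_
    ext : 1
    exact ringTensor_hom_ext fun a y => congrArg ULift.up (h p q hn a y)
  ext x
  exact congrArg ULift.down (ConcreteCategory.congr_hom this x)

lemma tensorComplex_d_mk {p q n m : ℤ} (hn : p + q = n) (hm : m + 1 = n) (a : A.X p) (y : F.X q) :
    (tensorComplex A F).d n m (tensorComplexMk hn a y) =
      tensorComplexMk (by lia) (A.d p (p - 1) a) y +
        (p.negOnePow : ℤ) • tensorComplexMk (by lia) a (F.d q (q - 1) y) := by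
  have h₁ := ConcreteCategory.congr_hom (HomologicalComplex.mapBifunctor.ι_D₁ A F
    (tensorBifunctor R) (ComplexShape.down ℤ) n m p q hn) (ringTmul R a y)
  have h₂ := ConcreteCategory.congr_hom (HomologicalComplex.mapBifunctor.ι_D₂ A F
    (tensorBifunctor R) (ComplexShape.down ℤ) n m p q hn) (ringTmul R a y)
  rw [HomologicalComplex.mapBifunctor.d₁_eq A F (tensorBifunctor R) (ComplexShape.down ℤ)
    (i₁ := p) (i₁' := p - 1) (by simp) q m (by change p - 1 + q = m; lia)] at h₁
  rw [HomologicalComplex.mapBifunctor.d₂_eq A F (tensorBifunctor R) (ComplexShape.down ℤ)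
    p (i₂ := q) (i₂' := q - 1) (by simp) m (by change p + (q - 1) = m; lia)] at h₂
  refine (congrArg₂ (· + ·) h₁ h₂).trans ?_
  refine congrArg₂ (· + ·) ?_ ?_
  · exact one_smul ℤ _
  · rfl

lemma tensorComplexCharacter_d {n m : ℤ} (hm : m + 1 = n)
    (h : ∀ p q : ℤ, A.X p →ₗ[Rᵐᵒᵖ] (F.X q →+ UnitAddCircle)) {p q : ℤ} (hn : p + q = n)
    (a : A.X p) (y : F.X q) :
    tensorComplexCharacter h m ((tensorComplex A F).d n m (tensorComplexMk hn a y)) =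
      h (p - 1) q (A.d p (p - 1) a) y + (p.negOnePow : ℤ) • h p (q - 1) a (F.d q (q - 1) y) := by
  rw [tensorComplex_d_mk hn hm, map_add, map_zsmul, tensorComplexCharacter_mk,
    tensorComplexCharacter_mk]

lemma exists_eq_tensorComplexCharacter {n : ℤ} (χ : (tensorComplex A F).X n →+ UnitAddCircle) :
    ∃ h : ∀ p q : ℤ, A.X p →ₗ[Rᵐᵒᵖ] (F.X q →+ UnitAddCircle), χ = tensorComplexCharacter h n := by
  refine ⟨fun p q => if hn : p + q = n then characterPairing (χ.comp
    (HomologicalComplex.ιMapBifunctor A F (tensorBifunctor R) (ComplexShape.down ℤ)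
      p q n hn).hom) else 0, tensorComplex_character_ext fun p q hn a y => ?_⟩
  rw [tensorComplexCharacter_mk, dif_pos hn]
  rfl

/-- A character of the direct sum (A ⊗ F)_n is a family of balanced pairings indexed by p + q = n.
The families `h` and `g` are indexed by all p, q, but only these degrees, and those with p + q = n -
1 for `g`, carry information. -/
lemma tensorComplex_acyclic_iff :
    (tensorComplex A F).Acyclic ↔
      ∀ (n : ℤ) (h : ∀ p q : ℤ, A.X p →ₗ[Rᵐᵒᵖ] (F.X q →+ UnitAddCircle)),
        (∀ p p' q q', p' + 1 = p → q' + 1 = q → p + q = n + 1 → ∀ a y,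
          h p' q (A.d p p' a) y + (p.negOnePow : ℤ) • h p q' a (F.d q q' y) = 0) →
        ∃ g : ∀ p q : ℤ, A.X p →ₗ[Rᵐᵒᵖ] (F.X q →+ UnitAddCircle),
          ∀ p p' q q', p' + 1 = p → q' + 1 = q → p + q = n → ∀ a y,
            g p' q (A.d p p' a) y + (p.negOnePow : ℤ) • g p q' a (F.d q q' y) = h p q a y := by
  rw [acyclic_iff_character]
  refine forall_congr' fun n => ⟨fun H h hh => ?_, fun H χ hχ => ?_⟩
  · obtain ⟨χ', hχ'⟩ := H (tensorComplexCharacter h n) (DFunLike.congr_fun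
      (tensorComplex_character_ext (χ := (tensorComplexCharacter h n).comp
        ((tensorComplex A F).d (n + 1) n).hom) (χ' := 0) fun p q hn a y =>
          (tensorComplexCharacter_d rfl h hn a y).trans
            (hh p _ q _ (sub_add_cancel p 1) (sub_add_cancel q 1) hn a y)))
    obtain ⟨g, rfl⟩ := exists_eq_tensorComplexCharacter χ'
    refine ⟨g, fun p p' q q' hp hq hn a y => ?_⟩
    obtain rfl : p' = p - 1 := by lia
    obtain rfl : q' = q - 1 := by lia
    rw [← tensorComplexCharacter_d (sub_add_cancel n 1) g hn, hχ', tensorComplexCharacter_mk]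
  · obtain ⟨h, rfl⟩ := exists_eq_tensorComplexCharacter χ
    obtain ⟨g, hg⟩ := H h fun p p' q q' hp hq hn a y => by
      obtain rfl : p' = p - 1 := by lia
      obtain rfl : q' = q - 1 := by lia
      rw [← tensorComplexCharacter_d rfl h hn, hχ]
    refine ⟨tensorComplexCharacter g (n - 1), DFunLike.congr_fun
      (tensorComplex_character_ext (χ := (tensorComplexCharacter g (n - 1)).comp
        ((tensorComplex A F).d n (n - 1)).hom) fun p q hn a y => ?_)⟩
    refine (tensorComplexCharacter_d (sub_add_cancel n 1) g hn a y).trans ?_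
    rw [hg p _ q _ (sub_add_cancel p 1) (sub_add_cancel q 1) hn, tensorComplexCharacter_mk]

end

lemma exists_character_of_acyclic {R : Type u} [Ring R] {K : ChainComplex (ModuleCat.{v} R) ℤ}
    (hK : K.Acyclic) {i j k : ℤ} (hi : j + 1 = i) (hk : k + 1 = j) (χ : K.X j →+ UnitAddCircle)
    (hχ : ∀ x, χ (K.d i j x) = 0) : ∃ χ' : K.X k →+ UnitAddCircle, ∀ x, χ' (K.d j k x) = χ x :=
  (exact_iff_character (K.d i j).hom.toAddMonoidHom (K.d j k).hom.toAddMonoidHom).1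
    ((acyclic_iff_exact K).1 hK i j k hi hk) χ hχ

/-! ### Dual retractions -/

section

variable {R : Type u} [Ring R]

/-- The map induced by `π` on character complexes is a split monomorphism of complexes of right
`R`-modules. -/
def HasDualRetraction {M F : ChainComplex (ModuleCat.{v} R) ℤ} (π : M ⟶ F) : Prop :=
  ∃ σ : ∀ q, (M.X q →+ UnitAddCircle) →ₗ[Rᵐᵒᵖ] (F.X q →+ UnitAddCircle),
    (∀ p q χ y, σ p (characterMap (M.d p q).hom χ) y = σ q χ (F.d p q y)) ∧
      ∀ q ξ, σ q (characterMap (π.f q).hom ξ) = ξ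

lemma d_d_apply (K : ChainComplex (ModuleCat.{v} R) ℤ) (i j k : ℤ) (x : K.X i) :
    K.d j k (K.d i j x) = 0 :=
  ConcreteCategory.congr_hom (K.d_comp_d i j k) x

lemma hom_comm_apply {K L : ChainComplex (ModuleCat.{v} R) ℤ} (f : K ⟶ L) (i j : ℤ) (x : K.X i) :
    f.f j (K.d i j x) = L.d i j (f.f i x) :=
  (ConcreteCategory.congr_hom (f.comm i j) x).symm

/-- The complex of right `R`-modules consisting of the characters of a complex. -/
abbrev dualComplex (K : ChainComplex (ModuleCat.{v} R) ℤ) : ChainComplex (ModuleCat.{v} Rᵐᵒᵖ) ℤ where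
  X p := ModuleCat.of Rᵐᵒᵖ (K.X (-p) →+ UnitAddCircle)
  -- With this sign, both terms of the pairing conditions for the tensor product carry the common
  -- factor (-1)^p.
  d p q := ModuleCat.ofHom ((p.negOnePow : ℤ) • characterMap (K.d (-q) (-p)).hom)
  shape p q hpq := by
    have : K.d (-q) (-p) = 0 := K.shape _ _ fun h => hpq (by
      change -p + 1 = -q at h
      change q + 1 = p
      lia)
    ext χ y
    simp [this]
  d_comp_d' p q r _ _ := by
    ext χ y
    have : χ (K.d (-q) (-p) (K.d (-r) (-q) y)) = 0 := by rw [d_d_apply, map_zero]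
    simp [this]

lemma dualComplex_d_apply (K : ChainComplex (ModuleCat.{v} R) ℤ) (p q : ℤ)
    (χ : K.X (-p) →+ UnitAddCircle) :
    (dualComplex K).d p q χ = (p.negOnePow : ℤ) • characterMap (K.d (-q) (-p)).hom χ := rfl

lemma negOnePow_smul_eq_zero_iff {M : Type*} [AddCommGroup M] (p : ℤ) (m : M) :
    (p.negOnePow : ℤ) • m = 0 ↔ m = 0 := by
  rcases Int.units_eq_one_or p.negOnePow with h | h <;> simp [h]

lemma negOnePow_smul_smul {M : Type*} [AddCommGroup M] (p : ℤ) (m : M) :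
    (p.negOnePow : ℤ) • (p.negOnePow : ℤ) • m = m := by
  rcases Int.units_eq_one_or p.negOnePow with h | h <;> simp [h]

lemma dualComplex_acyclic {K : ChainComplex (ModuleCat.{v} R) ℤ} (hK : K.Acyclic) :
    (dualComplex K).Acyclic := by
  rw [acyclic_iff_exact]
  intro i j k hi hk χ hχ
  rw [dualComplex_d_apply, negOnePow_smul_eq_zero_iff] at hχ
  obtain ⟨χ', h'⟩ := exists_character_of_acyclic (i := -k) (k := -i) hK (by lia) (by lia) χ
    (DFunLike.congr_fun hχ)
  refine ⟨(i.negOnePow : ℤ) • χ', ?_⟩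
  rw [map_zsmul, dualComplex_d_apply, negOnePow_smul_smul]
  exact AddMonoidHom.ext h'

/-- A chain map of degree `-1` from the characters of an acyclic complex to the characters of a
semi-flat complex is null-homotopic. -/
lemma IsSemiFlat.exists_homotopy {K F : ChainComplex (ModuleCat.{v} R) ℤ} (hF : IsSemiFlat F)
    (hK : K.Acyclic) (δ : ∀ i j, (K.X j →+ UnitAddCircle) →ₗ[Rᵐᵒᵖ] (F.X i →+ UnitAddCircle))
    (hδ : ∀ i j k, j + 1 = i → k + 1 = j → ∀ χ y,
      δ i j (characterMap (K.d j k).hom χ) y + δ j k χ (F.d i j y) = 0) :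
    ∃ G : ∀ i, (K.X i →+ UnitAddCircle) →ₗ[Rᵐᵒᵖ] (F.X i →+ UnitAddCircle),
      ∀ i j, j + 1 = i → ∀ χ y,
        δ i j χ y = G j χ (F.d i j y) - G i (characterMap (K.d i j).hom χ) y := by
  -- The dual complex has the characters of K_{-p} in degree p, so δ i j pairs degrees -j and i,
  -- whose sum is 1 when j + 1 = i.
  obtain ⟨g, hg⟩ := tensorComplex_acyclic_iff.1 (hF.acyclic _ (dualComplex_acyclic hK)) 1
    (fun p q => δ q (-p)) (by
      intro p p' q q' hp hq hn a y
      obtain rfl : q' = -p' := by lia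
      rw [dualComplex_d_apply, map_zsmul, AddMonoidHom.coe_smul, Pi.smul_apply, ← smul_add,
        hδ _ _ _ hq (by lia), smul_zero])
  let G (j q : ℤ) : (K.X j →+ UnitAddCircle) →ₗ[Rᵐᵒᵖ] (F.X q →+ UnitAddCircle) :=
    (g (-j) q).comp (characterMap (K.XIsoOfEq (neg_neg j)).hom.hom)
  have hG (p q : ℤ) : G (-p) q = g p q := by
    have : ∀ p' (h : p' = p), (g p' q).comp
      (characterMap (K.XIsoOfEq (congrArg (- ·) h)).hom.hom) = g p q := by
      rintro _ rfl
      rfl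
    exact this (- -p) (neg_neg p)
  -- The alternating sign turns the sum in the tensor differential into the difference required of a
  -- homotopy.
  refine ⟨fun i => (i.negOnePow : ℤ) • G i i, fun i j hi χ y => ?_⟩
  obtain ⟨p, rfl⟩ : ∃ p, j = -p := ⟨-j, by simp⟩
  obtain ⟨p', rfl⟩ : ∃ p', i = -p' := ⟨-i, by simp⟩
  have := hg p p' (-p') (-p) (by lia) hi (by lia) χ y
  have hs : p.negOnePow = - p'.negOnePow := by
    rw [show p = p' + 1 by lia, Int.negOnePow_succ]
  rw [dualComplex_d_apply, map_zsmul] at this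
  rw [← this]
  simp [hG, hs, Int.negOnePow_neg]
  abel

lemma exists_linearMap_factorization {R M N P : Type*} [Ring R] [AddCommGroup M] [Module R M]
    [AddCommGroup N] [Module R N] [AddCommGroup P] [Module R P] (f : M →ₗ[R] N)
    (hf : Function.Surjective f) (g : M →ₗ[R] P) (h : ∀ m, f m = 0 → g m = 0) :
    ∃ g' : N →ₗ[R] P, ∀ m, g' (f m) = g m :=
  ⟨(Submodule.liftQ f.ker g h).comp (f.quotKerEquivOfSurjective hf).symm.toLinearMap, fun m => by
    have : (f.quotKerEquivOfSurjective hf).symm (f m) = Submodule.Quotient.mk m := by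
      rw [LinearEquiv.symm_apply_eq]
      rfl
    exact congrArg (Submodule.liftQ f.ker g h) this⟩

/-- A semi-flat complex has dual retractions along surjective quasi-isomorphisms. -/
theorem IsSemiFlat.hasDualRetraction {S : ShortComplex (ChainComplex (ModuleCat.{v} R) ℤ)}
    (hS : S.ShortExact) (hK : S.X₁.Acyclic) (hF : IsSemiFlat S.X₃) : HasDualRetraction S.g := by
  have hd (i : ℤ) : (S.map (HomologicalComplex.eval _ _ i)).ShortExact :=
    hS.map_of_exact (HomologicalComplex.eval _ _ i)
  have hι (i : ℤ) : Function.Injective (S.f.f i) := (hd i).moduleCat_injective_f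
  have hπ (i : ℤ) : Function.Surjective (S.g.f i) := (hd i).moduleCat_surjective_g
  have hex (i : ℤ) (x : S.X₂.X i) (hx : S.g.f i x = 0) : ∃ y, S.f.f i y = x :=
    (ShortComplex.moduleCat_exact_iff _).1 (hd i).exact x hx
  have hz (i : ℤ) (x : S.X₁.X i) : S.g.f i (S.f.f i x) = 0 :=
    ConcreteCategory.congr_hom (HomologicalComplex.congr_hom S.zero i) x
  -- retractions in each degree
  have hρ (i : ℤ) : ∃ ρ : (S.X₂.X i →+ UnitAddCircle) →ₗ[Rᵐᵒᵖ] (S.X₃.X i →+ UnitAddCircle),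
      ∀ ξ, ρ (characterMap (S.g.f i).hom ξ) = ξ := by
    refine (isFlatModule_iff _).1 (hF.flat i) (ModuleCat.of _ (S.X₃.X i →+ UnitAddCircle))
      (ModuleCat.of _ (S.X₂.X i →+ UnitAddCircle)) (ModuleCat.ofHom (characterMap (S.g.f i).hom))
      (fun ξ ξ' h => AddMonoidHom.ext fun y => ?_) LinearMap.id
    obtain ⟨x, rfl⟩ := hπ i y
    exact DFunLike.congr_fun h x
  choose ρ hρ using hρ
  let res (j : ℤ) : (S.X₂.X j →+ UnitAddCircle) →ₗ[Rᵐᵒᵖ] (S.X₁.X j →+ UnitAddCircle) :=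
    characterMap (S.f.f j).hom
  have hres (j : ℤ) : Function.Surjective (res j) := fun χ =>
    (exists_character_extension (S.f.f j).hom.toAddMonoidHom (hι j) χ).imp fun χ' h =>
      AddMonoidHom.ext h
  -- The defect of `ρ` as a chain map. It vanishes on characters pulled back from F, hence depends
  -- only on the restriction of a character to the kernel.
  let δ (i j : ℤ) : (S.X₂.X j →+ UnitAddCircle) →ₗ[Rᵐᵒᵖ] (S.X₃.X i →+ UnitAddCircle) :=
    (ρ i).comp (characterMap (S.X₂.d i j).hom) - (characterMap (S.X₃.d i j).hom).comp (ρ j)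
  have hδ (i j : ℤ) : ∃ δ' : (S.X₁.X j →+ UnitAddCircle) →ₗ[Rᵐᵒᵖ] (S.X₃.X i →+ UnitAddCircle),
      ∀ χ, δ' (res j χ) = δ i j χ := by
    refine exists_linearMap_factorization (res j) (hres j) (δ i j) fun χ hχ => ?_
    obtain ⟨ξ, hξ⟩ := exists_character_factorization (S.g.f j).hom.toAddMonoidHom χ fun m hm => by
      obtain ⟨k, rfl⟩ := hex j m hm
      exact DFunLike.congr_fun hχ k
    obtain rfl : characterMap (S.g.f j).hom ξ = χ := AddMonoidHom.ext hξ
    have : characterMap (S.X₂.d i j).hom (characterMap (S.g.f j).hom ξ) =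
        characterMap (S.g.f i).hom (characterMap (S.X₃.d i j).hom ξ) :=
      AddMonoidHom.ext fun x =>
        congrArg ξ (ConcreteCategory.congr_hom (S.g.comm i j) x).symm
    simp [δ, hρ, this]
  choose δ' hδ' using hδ
  obtain ⟨G, hG⟩ := hF.exists_homotopy hK δ' fun i j k _ _ χ y => by
    obtain ⟨χ, rfl⟩ := hres k χ
    have h₁ : characterMap (S.X₁.d j k).hom (res k χ) = res j (characterMap (S.X₂.d j k).hom χ) :=
      AddMonoidHom.ext fun x => congrArg χ (hom_comm_apply S.f j k x)
    have h₂ : characterMap (S.X₂.d i j).hom (characterMap (S.X₂.d j k).hom χ) = 0 :=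
      AddMonoidHom.ext fun x => (congrArg χ (d_d_apply S.X₂ i j k x)).trans (map_zero χ)
    have h₃ := d_d_apply S.X₃ i j k y
    rw [h₁, hδ', hδ']
    simp [δ, h₂, h₃]
  -- The correction vanishes on characters pulled back from F, since these restrict to zero on the
  -- kernel; so this is still a retraction.
  refine ⟨fun q => ρ q + (G q).comp (res q), fun i j χ y => ?_, fun q ξ => ?_⟩
  · by_cases hij : j + 1 = i
    · have h := hG i j hij (res j χ) y
      have h₁ : characterMap (S.X₁.d i j).hom (res j χ) = res i (characterMap (S.X₂.d i j).hom χ) :=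
        AddMonoidHom.ext fun x => congrArg χ (hom_comm_apply S.f i j x)
      rw [hδ', h₁] at h
      simp only [δ, LinearMap.sub_apply, LinearMap.comp_apply, AddMonoidHom.sub_apply,
        characterMap_apply] at h
      simp only [LinearMap.add_apply, LinearMap.comp_apply, AddMonoidHom.add_apply]
      rw [← sub_eq_zero] at h ⊢
      rw [← h]
      abel
    · have h₁ : S.X₂.d i j = 0 := S.X₂.shape _ _ hij
      have h₂ : S.X₃.d i j = 0 := S.X₃.shape _ _ hij
      have h₃ : characterMap (0 : S.X₂.X i →ₗ[R] S.X₂.X j) χ = 0 :=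
        AddMonoidHom.ext fun x => map_zero χ
      simp [h₁, h₂, h₃]
  · have : res q (characterMap (S.g.f q).hom ξ) = 0 :=
      AddMonoidHom.ext fun x => (congrArg ξ (hz q x)).trans (map_zero ξ)
    simp [this, hρ]

end

/-! ### Pairings with free modules and semi-free complexes -/

section

variable {R : Type*} [Ring R] {M N : Type*} [AddCommGroup M] [Module Rᵐᵒᵖ M] [AddCommGroup N]
  [Module R N] {E : Type*}

/-- The balanced pairing of `M` with a free module that takes prescribed values on a basis. -/
def basisPairing (b : Module.Basis E R N) (γ : E → M →+ UnitAddCircle) :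
    M →ₗ[Rᵐᵒᵖ] (N →+ UnitAddCircle) where
  toFun m := (Finsupp.liftAddHom fun e =>
    (γ e).comp (AddMonoidHom.mk' (fun c : R => MulOpposite.op c • m) fun c c' => by
      rw [MulOpposite.op_add, add_smul])).comp b.repr.toLinearMap.toAddMonoidHom
  map_add' m m' := by
    ext n
    change (b.repr n).sum (fun e c => γ e (MulOpposite.op c • (m + m'))) =
      (b.repr n).sum (fun e c => γ e (MulOpposite.op c • m)) +
        (b.repr n).sum (fun e c => γ e (MulOpposite.op c • m'))
    simp only [smul_add, map_add, Finsupp.sum_add]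
  map_smul' r m := by
    ext n
    change (b.repr n).sum (fun e c => γ e (MulOpposite.op c • r • m)) =
      (b.repr (r.unop • n)).sum (fun e c => γ e (MulOpposite.op c • m))
    rw [map_smul, Finsupp.sum_smul_index (by simp)]
    simp only [MulOpposite.op_mul, MulOpposite.op_unop, mul_smul]

@[simp]
lemma basisPairing_basis (b : Module.Basis E R N) (γ : E → M →+ UnitAddCircle) (m : M) (e : E) :
    basisPairing b γ m (b e) = γ e m := by
  simp [basisPairing]

/-- Balancedness moves a scalar from n to m, which is why agreement on `s` is assumed for all m at
once. -/
lemma pairing_eqOn_span {h h' : M →ₗ[Rᵐᵒᵖ] (N →+ UnitAddCircle)} {s : Set N}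
    (H : ∀ n ∈ s, ∀ m, h m n = h' m n) {n : N} (hn : n ∈ Submodule.span R s) (m : M) :
    h m n = h' m n := by
  induction hn using Submodule.span_induction generalizing m with
  | mem n hn => exact H n hn m
  | zero => simp
  | add x y _ _ hx hy => rw [map_add, map_add, hx, hy]
  | smul r x _ hx =>
    have := hx (MulOpposite.op r • m)
    rwa [map_smul, map_smul] at this

end

section

variable {R : Type u} [Ring R]

/-- Pulled back to L, the pairing can be extended one basis element at a time, extending a character
each time; `σ` then returns to F. -/
lemma IsFlatModule.of_basis_of_retraction {L F : ModuleCat.{v} R} {E : Type*}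
    (b : Module.Basis E R L) (π : L ⟶ F)
    (σ : (L →+ UnitAddCircle) →ₗ[Rᵐᵒᵖ] (F →+ UnitAddCircle))
    (hσ : ∀ ξ, σ (characterMap π.hom ξ) = ξ) : IsFlatModule F := by
  refine (isFlatModule_iff F).2 fun M M' f hf h => ?_
  choose γ hγ using fun e : E => exists_character_extension f.hom.toAddMonoidHom hf
    ((AddMonoidHom.eval (π (b e))).comp h.toAddMonoidHom)
  refine ⟨σ.comp (basisPairing b γ), fun m => ?_⟩
  rw [LinearMap.comp_apply, ← hσ (h m)]
  congr 1
  ext y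
  refine pairing_eqOn_span (h := (basisPairing b γ).comp f.hom)
    (h' := (characterMap π.hom).comp h) (s := Set.range b) ?_ (by simp) m
  rintro _ ⟨e, rfl⟩ m
  simpa using hγ e m

/-- At a basis element e the equation prescribes χ ∘ d for the unknown character χ of A_p, in terms
of `h` and of the values of `g` on ∂e, which involves lower levels only. The prescribed character
vanishes on boundaries, so exactness of A provides χ. -/
theorem IsSemiFree.exists_pairing {A : ChainComplex (ModuleCat.{v} Rᵐᵒᵖ) ℤ} (hA : A.Acyclic)
    {L : ChainComplex (ModuleCat.{v} R) ℤ} (hL : IsSemiFree L) (n : ℤ)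
    (h : ∀ p q : ℤ, A.X p →ₗ[Rᵐᵒᵖ] (L.X q →+ UnitAddCircle))
    (hh : ∀ p p' q q', p' + 1 = p → q' + 1 = q → p + q = n + 1 → ∀ a y,
      h p' q (A.d p p' a) y + (p.negOnePow : ℤ) • h p q' a (L.d q q' y) = 0) :
    ∃ g : ∀ p q : ℤ, A.X p →ₗ[Rᵐᵒᵖ] (L.X q →+ UnitAddCircle),
      ∀ p p' q q', p' + 1 = p → q' + 1 = q → p + q = n → ∀ a y,
        g p' q (A.d p p' a) y + (p.negOnePow : ℤ) • g p q' a (L.d q q' y) = h p q a y := by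
  classical
  obtain ⟨E, b, level, hb⟩ := hL
  let g (γ : ∀ (q) (_ : E q) (p : ℤ), A.X p →+ UnitAddCircle) (p q : ℤ) :
      A.X p →ₗ[Rᵐᵒᵖ] (L.X q →+ UnitAddCircle) := basisPairing (b q) fun e => γ q e p
  let lev (x : Σ q, E q) : ℕ := level x.1 x.2
  -- the condition at a basis element on the values `χ` there and `γ` at lower elements
  let Good (x : Σ q, E q) (γ : ∀ (q) (_ : E q) (p : ℤ), A.X p →+ UnitAddCircle) (p : ℤ)
      (χ : A.X p →+ UnitAddCircle) : Prop :=
    ∀ a : A.X (p + 1), χ (A.d (p + 1) p a) + ((p + 1).negOnePow : ℤ) •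
      g γ (p + 1) (x.1 - 1) a (L.d x.1 (x.1 - 1) (b x.1 x.2)) = h (p + 1) x.1 a (b x.1 x.2)
  let trunc (x : Σ q, E q) (rec : ∀ y : Σ q, E q, lev y < lev x → ∀ p : ℤ, A.X p →+ UnitAddCircle) :
      ∀ (q) (_ : E q) (p : ℤ), A.X p →+ UnitAddCircle :=
    fun q e p => if hlt : level q e < lev x then rec ⟨q, e⟩ hlt p else 0
  -- A solution is chosen when there is one, with default 0; that it exists in the relevant degrees
  -- is proved afterwards, in `key`.
  let Γ : ∀ x : Σ q, E q, ∀ p : ℤ, A.X p →+ UnitAddCircle :=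
    (measure lev).wf.fix fun x rec p =>
      if hx : ∃ χ, Good x (trunc x rec) p χ then hx.choose else 0
  let γ : ∀ (q) (_ : E q) (p : ℤ), A.X p →+ UnitAddCircle := fun q e p => Γ ⟨q, e⟩ p
  -- only lower elements matter
  have hg (x : Σ q, E q) (p : ℤ) (a : A.X p) :
      g (trunc x fun y _ => Γ y) p (x.1 - 1) a (L.d x.1 (x.1 - 1) (b x.1 x.2)) =
        g γ p (x.1 - 1) a (L.d x.1 (x.1 - 1) (b x.1 x.2)) := by
    refine pairing_eqOn_span ?_ (hb x.1 x.2) a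
    rintro _ ⟨e, he, rfl⟩ m
    simp only [g, basisPairing_basis, trunc, γ]
    rw [dif_pos (show level (x.1 - 1) e < lev x from he)]
  have hΓ (x : Σ q, E q) (p : ℤ) (hx : ∃ χ, Good x γ p χ) : Good x γ p (Γ x p) := by
    have hGood (χ) : Good x (trunc x fun y _ => Γ y) p χ ↔ Good x γ p χ := by
      simp only [Good, hg]
    have hx' : ∃ χ, Good x (trunc x fun y _ => Γ y) p χ := hx.imp fun χ => (hGood χ).2
    have : Γ x p = hx'.choose := by
      simp only [Γ]
      rw [WellFounded.fix_eq]
      exact dif_pos hx'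
    rw [this, ← hGood]
    exact hx'.choose_spec
  have key : ∀ (N : ℕ) (x : Σ q, E q), lev x < N → ∀ p, p + 1 + x.1 = n → Good x γ p (Γ x p) := by
    intro N
    induction N with
    | zero => exact fun x hx => absurd hx (Nat.not_lt_zero _)
    | succ N ih =>
      rintro ⟨q, e⟩ hx p hp
      refine hΓ _ p ?_
      -- To see that the prescribed character kills boundaries, combine `hh` at e with the equations
      -- already solved at lower levels, extended linearly to ∂e, where ∂∂e = 0 removes a term.
      obtain ⟨χ, hχ⟩ := exists_character_of_acyclic hA (i := p + 1 + 1) (j := p + 1) (k := p)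
        rfl rfl ((AddMonoidHom.eval (b q e)).comp (h (p + 1) q).toAddMonoidHom -
          ((p + 1).negOnePow : ℤ) • (AddMonoidHom.eval (L.d q (q - 1) (b q e))).comp
            (g γ (p + 1) (q - 1)).toAddMonoidHom) (fun a => by
        have h₁ := hh (p + 1 + 1) (p + 1) q (q - 1) rfl (by lia) (by dsimp at hp; lia) a (b q e)
        have h₂ := pairing_eqOn_span (h := (g γ (p + 1) (q - 1)).comp (A.d (p + 1 + 1) (p + 1)).hom
            + ((p + 1 + 1).negOnePow : ℤ) • (characterMap (L.d (q - 1) (q - 1 - 1)).hom).comp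
              (g γ (p + 1 + 1) (q - 1 - 1))) (h' := h (p + 1 + 1) (q - 1)) (by
          rintro _ ⟨e', he', rfl⟩ a
          have := ih ⟨q - 1, e'⟩ (by dsimp [lev] at hx he' ⊢; lia) (p + 1) (by dsimp at hp ⊢; lia) a
          simpa [g, γ] using this) (hb q e) a
        have h₃ := d_d_apply L q (q - 1) (q - 1 - 1) (b q e)
        rw [Int.negOnePow_succ (p + 1)] at h₁
        simp only [LinearMap.add_apply, LinearMap.comp_apply, LinearMap.smul_apply,
          AddMonoidHom.add_apply, AddMonoidHom.coe_smul, Pi.smul_apply, characterMap_apply] at h₂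
        rw [show ∀ y, (L.d (q - 1) (q - 1 - 1)).hom y = L.d (q - 1) (q - 1 - 1) y from fun _ => rfl,
          h₃, map_zero, smul_zero, add_zero] at h₂
        rw [← h₂, Units.val_neg, neg_smul, ← sub_eq_add_neg] at h₁
        exact h₁)
      refine ⟨χ, fun a => ?_⟩
      rw [hχ]
      simp
  refine ⟨g γ, fun p p' q q' hp hq hn a y => ?_⟩
  subst hp
  obtain rfl : q' = q - 1 := by lia
  refine pairing_eqOn_span (h := (g γ p' q).comp (A.d (p' + 1) p').hom +
    ((p' + 1).negOnePow : ℤ) • (characterMap (L.d q (q - 1)).hom).comp (g γ (p' + 1) (q - 1)))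
    (h' := h (p' + 1) q) (s := Set.range (b q)) ?_ (by simp) a
  rintro _ ⟨e, rfl⟩ a
  simpa [g, γ] using key _ ⟨q, e⟩ (Nat.lt_succ_self _) p' hn a

/-- Since `σ` is linear and commutes with differentials, it sends a solution of the pulled-back
problem on L to a solution on F. -/
theorem IsSemiFree.isSemiFlat_of_hasDualRetraction {L F : ChainComplex (ModuleCat.{v} R) ℤ}
    (hL : IsSemiFree L) (π : L ⟶ F) (hπ : HasDualRetraction π) : IsSemiFlat F := by
  obtain ⟨σ, hσ, hσπ⟩ := hπ
  refine ⟨fun i => ?_, fun A hA => tensorComplex_acyclic_iff.2 fun n h hh => ?_⟩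
  · obtain ⟨E, b, -⟩ := hL
    exact IsFlatModule.of_basis_of_retraction (b i) (π.f i) (σ i) (hσπ i)
  · obtain ⟨g, hg⟩ := hL.exists_pairing hA n (fun p q => (characterMap (π.f q).hom).comp (h p q))
      fun p p' q q' hp hq hn a y => by
        have := hh p p' q q' hp hq hn a (π.f q y)
        rw [← hom_comm_apply] at this
        exact this
    refine ⟨fun p q => (σ q).comp (g p q), fun p p' q q' hp hq hn a y => ?_⟩
    have : g p' q (A.d p p' a) + (p.negOnePow : ℤ) • characterMap (L.d q q').hom (g p q' a) =
        characterMap (π.f q).hom (h p q a) := AddMonoidHom.ext (hg p p' q q' hp hq hn a)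
    have := DFunLike.congr_fun (congrArg (σ q) this) y
    rw [hσπ, map_add, map_zsmul] at this
    rw [← this]
    simp [hσ]

end

/-! ### Relations between homogeneous elements -/

/-- The relations `x + y = z`, `r x = y` and `∂ x = y` between homogeneous generators. -/
inductive Relation (R : Type u) (G : ℤ → Type v) : Type (max u v)
  | add (q : ℤ) (x y z : G q)
  | smul (q : ℤ) (r : R) (x y : G q)
  | d (p q : ℤ) (x : G p) (y : G q)

namespace Relation

variable {R : Type u} {G : ℤ → Type v}

/-- The degree in which a relation takes place. -/
def deg : Relation R G → ℤ
  | add q _ _ _ => q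
  | smul q _ _ _ => q
  | d _ q _ _ => q

/-- The generators that occur in a relation. -/
def support : Relation R G → Set (Σ q, G q)
  | add q x y z => {⟨q, x⟩, ⟨q, y⟩, ⟨q, z⟩}
  | smul q _ x y => {⟨q, x⟩, ⟨q, y⟩}
  | d p q x y => {⟨p, x⟩, ⟨q, y⟩}

lemma finite_support (ρ : Relation R G) : ρ.support.Finite := by
  cases ρ <;> simp [support]

variable [Ring R]

/-- The value of a family of elements at a generator. -/
abbrev evalAt (X : ChainComplex (ModuleCat.{v} R) ℤ) (x : Σ q, G q) :
    (∀ y : Σ q, G q, X.X y.1) →+ X.X x.1 :=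
  Pi.evalAddMonoidHom (fun y : Σ q, G q => X.X y.1) x

open Classical in
/-- The family of elements that is supported at a single generator. -/
abbrev singleAt (X : ChainComplex (ModuleCat.{v} R) ℤ) (x : Σ q, G q) :
    X.X x.1 →+ ∀ y : Σ q, G q, X.X y.1 :=
  AddMonoidHom.single (fun y : Σ q, G q => X.X y.1) x

/-- The difference of the two sides of a relation, where the generators are replaced by elements of
a complex. -/
def eval (X : ChainComplex (ModuleCat.{v} R) ℤ) :
    (ρ : Relation R G) → (∀ y : Σ q, G q, X.X y.1) →+ X.X ρ.deg
  | add q x y z => evalAt X ⟨q, x⟩ + evalAt X ⟨q, y⟩ - evalAt X ⟨q, z⟩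
  | smul q r x y => (DistribSMul.toAddMonoidHom (X.X q) r).comp (evalAt X ⟨q, x⟩) -
      evalAt X ⟨q, y⟩
  | d p q x y => (X.d p q).hom.toAddMonoidHom.comp (evalAt X ⟨p, x⟩) - evalAt X ⟨q, y⟩

variable {X Y : ChainComplex (ModuleCat.{v} R) ℤ}

lemma eval_add (q : ℤ) (x y z : G q) (s : ∀ y : Σ q, G q, X.X y.1) :
    (add q x y z : Relation R G).eval X s = (s ⟨q, x⟩ + s ⟨q, y⟩ - s ⟨q, z⟩ : X.X q) := rfl

lemma eval_smul (q : ℤ) (r : R) (x y : G q) (s : ∀ y : Σ q, G q, X.X y.1) :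
    (smul q r x y : Relation R G).eval X s = (r • s ⟨q, x⟩ - s ⟨q, y⟩ : X.X q) := rfl

lemma eval_d (p q : ℤ) (x : G p) (y : G q) (s : ∀ y : Σ q, G q, X.X y.1) :
    (d p q x y : Relation R G).eval X s = (X.d p q (s ⟨p, x⟩) - s ⟨q, y⟩ : X.X q) := rfl

lemma eval_add_eq_zero_iff (q : ℤ) (x y z : G q) (s : ∀ y : Σ q, G q, X.X y.1) :
    (add q x y z : Relation R G).eval X s = 0 ↔ s ⟨q, x⟩ + s ⟨q, y⟩ = s ⟨q, z⟩ := by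
  rw [eval_add]
  exact sub_eq_zero

lemma eval_smul_eq_zero_iff (q : ℤ) (r : R) (x y : G q) (s : ∀ y : Σ q, G q, X.X y.1) :
    (smul q r x y : Relation R G).eval X s = 0 ↔ r • s ⟨q, x⟩ = s ⟨q, y⟩ := by
  rw [eval_smul]
  exact sub_eq_zero

lemma eval_d_eq_zero_iff (p q : ℤ) (x : G p) (y : G q) (s : ∀ y : Σ q, G q, X.X y.1) :
    (d p q x y : Relation R G).eval X s = 0 ↔ X.d p q (s ⟨p, x⟩) = s ⟨q, y⟩ := by
  rw [eval_d]
  exact sub_eq_zero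

lemma map_eval (f : X ⟶ Y) (ρ : Relation R G) (s : ∀ y : Σ q, G q, X.X y.1) :
    f.f ρ.deg (ρ.eval X s) = ρ.eval Y fun y => f.f y.1 (s y) := by
  cases ρ with
  | add q x y z =>
    rw [eval_add, eval_add]
    exact (map_sub (f.f q).hom _ _).trans (congrArg (· - _) (map_add (f.f q).hom _ _))
  | smul q r x y =>
    rw [eval_smul, eval_smul]
    exact (map_sub (f.f q).hom _ _).trans (congrArg (· - _) (map_smul (f.f q).hom _ _))
  | d p q x y =>
    rw [eval_d, eval_d]
    exact (map_sub (f.f q).hom _ _).trans (congrArg (· - _) (hom_comm_apply f p q _))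

lemma eval_congr (ρ : Relation R G) {s t : ∀ y : Σ q, G q, X.X y.1}
    (h : ∀ y ∈ ρ.support, s y = t y) : ρ.eval X s = ρ.eval X t := by
  cases ρ with
  | add q x y z =>
    rw [eval_add, eval_add, h ⟨q, x⟩ (by simp [support]), h ⟨q, y⟩ (by simp [support]),
      h ⟨q, z⟩ (by simp [support])]
  | smul q r x y =>
    rw [eval_smul, eval_smul, h ⟨q, x⟩ (by simp [support]), h ⟨q, y⟩ (by simp [support])]
  | d p q x y =>
    rw [eval_d, eval_d, h ⟨p, x⟩ (by simp [support]), h ⟨q, y⟩ (by simp [support])]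

/-- A relation is built from sums, scalars and ∂, all of which `σ` respects; so `σ` takes the
coefficient of χ ∘ ρ at each generator in M to the corresponding coefficient in F. -/
lemma retraction_eval {M F : ChainComplex (ModuleCat.{v} R) ℤ}
    (σ : ∀ q, (M.X q →+ UnitAddCircle) →ₗ[Rᵐᵒᵖ] (F.X q →+ UnitAddCircle))
    (hσ : ∀ p q χ y, σ p (characterMap (M.d p q).hom χ) y = σ q χ (F.d p q y))
    (ρ : Relation R G) (y : Σ q, G q) (χ : M.X ρ.deg →+ UnitAddCircle) :
    σ y.1 ((χ.comp (ρ.eval M)).comp (singleAt M y)) =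
      ((σ ρ.deg χ).comp (ρ.eval F)).comp (singleAt F y) := by
  have h (x : Σ q, G q) (χ : M.X x.1 →+ UnitAddCircle) :
      σ y.1 ((χ.comp (evalAt M x)).comp
        (singleAt M y)) =
      ((σ x.1 χ).comp (evalAt F x)).comp
        (singleAt F y) := by
    by_cases hxy : x = y
    · subst hxy
      have h₁ : (χ.comp (evalAt M x)).comp
        (singleAt M x) = χ := by ext; simp
      rw [h₁]
      ext
      simp
    · have h₁ : (χ.comp (evalAt M x)).comp
        (singleAt M y) = 0 := by ext; simp [hxy]
      rw [h₁, map_zero]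
      ext
      simp [hxy]
  cases ρ with
  | add q x₁ x₂ x₃ =>
    change M.X q →+ UnitAddCircle at χ
    have := congrArg₂ (· - ·) (congrArg₂ (· + ·) (h ⟨q, x₁⟩ χ) (h ⟨q, x₂⟩ χ)) (h ⟨q, x₃⟩ χ)
    dsimp only at this
    rw [← map_add, ← map_sub] at this
    refine Eq.trans (congrArg (σ y.1) ?_) (this.trans ?_)
    · ext m
      exact (map_sub χ _ _).trans (congrArg (· - _) (map_add χ _ _))
    · ext m
      exact ((map_sub (σ q χ) _ _).trans (congrArg (· - _) (map_add (σ q χ) _ _))).symm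
  | smul q r x₁ x₂ =>
    change M.X q →+ UnitAddCircle at χ
    have := congrArg₂ (· - ·) (h ⟨q, x₁⟩ (MulOpposite.op r • χ)) (h ⟨q, x₂⟩ χ)
    dsimp only at this
    rw [← map_sub, map_smul] at this
    refine Eq.trans (congrArg (σ y.1) ?_) (this.trans ?_)
    · ext m
      exact map_sub χ _ _
    · ext m
      exact (map_sub (σ q χ) _ _).symm
  | d p q x₁ x₂ =>
    change M.X q →+ UnitAddCircle at χ
    have := congrArg₂ (· - ·) (h ⟨p, x₁⟩ (characterMap (M.d p q).hom χ)) (h ⟨q, x₂⟩ χ)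
    dsimp only at this
    rw [← map_sub, show σ p (characterMap (M.d p q).hom χ) = characterMap (F.d p q).hom (σ q χ) from
      AddMonoidHom.ext (hσ p q χ)] at this
    refine Eq.trans (congrArg (σ y.1) ?_) (this.trans ?_)
    · ext m
      exact map_sub χ _ _
    · ext m
      exact (map_sub (σ q χ) _ _).symm

end Relation

/-! ### Dual retractions and lifting of finite sets of relations -/

section

variable {R : Type u} [Ring R]

/-- A relation between homogeneous elements of `F` that holds in `F`. -/
abbrev TrueRelation (F : ChainComplex (ModuleCat.{u} R) ℤ) :=
  {ρ : Relation R (fun q => F.X q) // ρ.eval F (fun y => y.2) = 0}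

/-- Every finite set of relations that hold in `F` is respected by some section of `π`. -/
def LiftsFiniteRelations {M F : ChainComplex (ModuleCat.{u} R) ℤ} (π : M ⟶ F) : Prop :=
  ∀ T : Finset (TrueRelation F), ∃ s : ∀ y : (Σ q, F.X q), M.X y.1,
    (∀ y, π.f y.1 (s y) = y.2) ∧ ∀ ρ ∈ T, ρ.1.eval M s = 0

variable {M F : ChainComplex (ModuleCat.{u} R) ℤ} {π : M ⟶ F}

theorem HasDualRetraction.liftsFiniteRelations (h : HasDualRetraction π)
    (hπ : ∀ i, Function.Surjective (π.f i)) : LiftsFiniteRelations π := by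
  classical
  obtain ⟨σ, hσ, hσπ⟩ := h
  intro T
  choose s₀ hs₀ using fun y : (Σ q, F.X q) => hπ y.1 y.2
  let V (X : ChainComplex (ModuleCat.{u} R) ℤ) := ∀ y : (Σ q, F.X q), X.X y.1
  let ev : V M →+ ∀ ρ : T, M.X ρ.1.1.deg := AddMonoidHom.pi fun ρ => ρ.1.1.eval M
  let πV : V M →+ V F := AddMonoidHom.pi fun y =>
    (π.f y.1).hom.toAddMonoidHom.comp (Pi.evalAddMonoidHom _ y)
  -- The section `s₀` can be corrected by a family in the kernel of π exactly when its error is the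
  -- error of such a family.
  by_cases hs : ev s₀ ∈ πV.ker.map ev
  · obtain ⟨t, ht, hts⟩ := hs
    refine ⟨s₀ - t, fun y => ?_, fun ρ hρ => ?_⟩
    · have : π.f y.1 (t y) = 0 := congrFun ht y
      change π.f y.1 (s₀ y - t y) = y.2
      rw [map_sub, hs₀, this, sub_zero]
    · have : ρ.1.eval M t = ρ.1.eval M s₀ := congrFun hts ⟨ρ, hρ⟩
      rw [map_sub, this, sub_self]
  · exfalso
    obtain ⟨Θ, hΘ, hs⟩ := exists_character_of_notMem hs
    apply hs
    let χ (ρ : T) : M.X ρ.1.1.deg →+ UnitAddCircle := Θ.comp (AddMonoidHom.single (fun ρ : T => M.X ρ.1.1.deg) ρ)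
    have hχ (v) : Θ v = ∑ ρ, χ ρ (v ρ) := by
      conv_lhs => rw [← Finset.univ_sum_single v, map_sum]
      rfl
    let Y : Finset (Σ q, F.X q) := T.biUnion fun ρ => ρ.1.finite_support.toFinset
    have hsum (X : ChainComplex (ModuleCat.{u} R) ℤ) (t : V X) (ρ : T) :
        ρ.1.1.eval X t = ∑ y ∈ Y, ρ.1.1.eval X (Pi.single y (t y)) := by
      rw [← map_sum]
      refine Relation.eval_congr _ fun y hy => ?_
      have hy : y ∈ Y := Finset.mem_biUnion.2 ⟨ρ.1, ρ.2, by simpa using hy⟩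
      rw [Finset.sum_apply, Finset.sum_eq_single y, Pi.single_eq_same]
      · intro y' _ h
        rw [Pi.single_eq_of_ne h.symm]
      · exact fun h => absurd hy h
    let c (y : Σ q, F.X q) : M.X y.1 →+ UnitAddCircle :=
      ∑ ρ : T, ((χ ρ).comp (ρ.1.1.eval M)).comp (Relation.singleAt M y)
    -- `Θ` vanishes on errors of families in the kernel of π, in particular of those supported at
    -- one generator, so its coefficient `c y` factors through π.
    have hc (y) : ∃ ξ : F.X y.1 →+ UnitAddCircle, ∀ m, ξ (π.f y.1 m) = c y m := by
      refine exists_character_factorization (π.f y.1).hom.toAddMonoidHom (c y) fun m hm => ?_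
      have := hΘ _ ⟨Pi.single y m, funext fun y' => ?_, rfl⟩
      · rw [hχ] at this
        change ∑ ρ : T, χ ρ (ρ.1.1.eval M (Pi.single y m)) = 0 at this
        simpa [c] using this
      · change π.f y'.1 ((Pi.single y m : V M) y') = 0
        by_cases h : y' = y
        · subst h
          rw [Pi.single_eq_same]
          exact hm
        · rw [Pi.single_eq_of_ne h, map_zero]
    choose ξ hξ using hc
    have hσc (y) : ξ y = ∑ ρ : T, ((σ _ (χ ρ)).comp (ρ.1.1.eval F)).comp (Relation.singleAt F y) := by
      rw [← hσπ y.1 (ξ y), show characterMap (π.f y.1).hom (ξ y) = c y from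
        AddMonoidHom.ext (hξ y), map_sum]
      exact Finset.sum_congr rfl fun ρ _ => Relation.retraction_eval σ hσ _ _ _
    calc Θ (ev s₀) = ∑ ρ : T, χ ρ (ρ.1.1.eval M s₀) := hχ _
      _ = ∑ ρ : T, ∑ y ∈ Y, χ ρ (ρ.1.1.eval M (Pi.single y (s₀ y))) := by
        refine Finset.sum_congr rfl fun ρ _ => ?_
        rw [hsum M s₀ ρ, map_sum]
      _ = ∑ y ∈ Y, c y (s₀ y) := by
        rw [Finset.sum_comm]
        refine Finset.sum_congr rfl fun y _ => ?_
        simp [c]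
      _ = ∑ y ∈ Y, ∑ ρ : T, σ _ (χ ρ) (ρ.1.1.eval F (Pi.single y y.2)) := by
        refine Finset.sum_congr rfl fun y _ => ?_
        rw [← hξ, hs₀, hσc]
        simp
      _ = ∑ ρ : T, σ _ (χ ρ) (ρ.1.1.eval F fun y => y.2) := by
        rw [Finset.sum_comm]
        refine Finset.sum_congr rfl fun ρ _ => ?_
        rw [hsum F _ ρ, map_sum]
      _ = 0 := Finset.sum_eq_zero fun ρ _ => by rw [ρ.1.2, map_zero]

open Filter Topology in
-- Let σ(χ)(y) be the limit of χ(s_T(y)) over the finite sets T of relations. Each true relation is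
-- respected by s_T for large T, so additivity, linearity and compatibility with ∂ hold in the
-- limit.
theorem LiftsFiniteRelations.hasDualRetraction (h : LiftsFiniteRelations π) :
    HasDualRetraction π := by
  classical
  choose s hsπ hs using h
  let U : Ultrafilter (Finset (TrueRelation F)) := Ultrafilter.of atTop
  have hU (ρ : TrueRelation F) : ∀ᶠ T in (U : Filter (Finset (TrueRelation F))), ρ.1.eval M (s T) = 0 :=
    Ultrafilter.of_le atTop ((eventually_ge_atTop {ρ}).mono fun T hT =>
      hs T ρ (Finset.singleton_subset_iff.1 hT))
  -- Compactness of the circle ensures that the limit along the ultrafilter exists.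
  let l (f : Finset (TrueRelation F) → UnitAddCircle) : UnitAddCircle := (U.map f).lim
  have hl (f) : Tendsto f U (𝓝 (l f)) := (U.map f).le_nhds_lim
  have hl_eq {f : Finset (TrueRelation F) → UnitAddCircle} {c : UnitAddCircle}
      (hc : Tendsto f U (𝓝 c)) : l f = c := tendsto_nhds_unique (hl f) hc
  have hl_congr {f g : Finset (TrueRelation F) → UnitAddCircle}
      (hfg : ∀ᶠ T in (U : Filter (Finset (TrueRelation F))), f T = g T) : l f = l g :=
    hl_eq ((hl g).congr' (EventuallyEq.symm hfg))
  have hl_add (f g : Finset (TrueRelation F) → UnitAddCircle) :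
      l (fun T => f T + g T) = l f + l g := hl_eq ((hl f).add (hl g))
  let σ (q : ℤ) : (M.X q →+ UnitAddCircle) →ₗ[Rᵐᵒᵖ] (F.X q →+ UnitAddCircle) :=
    { toFun χ := AddMonoidHom.mk' (fun y => l fun T => χ (s T ⟨q, y⟩)) fun y y' => by
        rw [← hl_add]
        refine hl_congr ((hU ⟨.add q y y' (y + y'), (Relation.eval_add_eq_zero_iff ..).2 rfl⟩).mono
          fun T hT => ?_)
        rw [← map_add, (Relation.eval_add_eq_zero_iff ..).1 hT]
      map_add' χ χ' := AddMonoidHom.ext fun y => hl_add _ _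
      map_smul' r χ := AddMonoidHom.ext fun y => hl_congr
        ((hU ⟨.smul q r.unop y (r.unop • y), (Relation.eval_smul_eq_zero_iff ..).2 rfl⟩).mono
          fun T hT => congrArg χ ((Relation.eval_smul_eq_zero_iff ..).1 hT)) }
  refine ⟨σ, fun p q χ y => ?_, fun q ξ => AddMonoidHom.ext fun y => ?_⟩
  · exact hl_congr ((hU ⟨.d p q y (F.d p q y), (Relation.eval_d_eq_zero_iff ..).2 rfl⟩).mono
      fun T hT => congrArg χ ((Relation.eval_d_eq_zero_iff ..).1 hT))
  · refine hl_eq (tendsto_const_nhds.congr fun T => ?_)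
    exact congrArg ξ (hsπ T ⟨q, y⟩).symm

end

/-! ### Complexes given by generators and relations -/

section

variable {R : Type u} [Ring R]

variable (R) in
/-- The disk complex, freely generated by an element of degree `n`. -/
def disk (n : ℤ) : ChainComplex (ModuleCat.{u} R) ℤ :=
  HomologicalComplex.evalCompCoyonedaCorepresentative (ComplexShape.down ℤ) (ModuleCat.of R R) n

/-- Elements of a module are the same as maps from the ring. -/
def homEquivElement (M : ModuleCat.{u} R) : (ModuleCat.of R R ⟶ M) ≃ M where
  toFun f := f.hom (1 : R)
  invFun x := ModuleCat.ofHom (LinearMap.toSpanSingleton R M x)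
  left_inv f := by
    ext
    exact one_smul R _
  right_inv x := one_smul R x

/-- Morphisms from a disk are elements. -/
def diskCorepresentable (n : ℤ) :
    (HomologicalComplex.eval (ModuleCat.{u} R) (ComplexShape.down ℤ) n ⋙
      forget (ModuleCat.{u} R)).CorepresentableBy (disk R n) where
  homEquiv {X} := (HomologicalComplex.evalCompCoyonedaCorepresentable (ComplexShape.down ℤ)
      (ModuleCat.of R R) n).homEquiv.trans (homEquivElement (X.X n))
  homEquiv_comp g f := congrArg (homEquivElement _)
    ((HomologicalComplex.evalCompCoyonedaCorepresentable (ComplexShape.down ℤ)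
      (ModuleCat.of R R) n).homEquiv_comp g f)

variable (R) in
/-- The generator of the disk complex. -/
def diskGen (n : ℤ) : (disk R n).X n :=
  (diskCorepresentable n).homEquiv (𝟙 _)

/-- The morphism from the disk complex given by an element. -/
def diskHom {X : ChainComplex (ModuleCat.{u} R) ℤ} {n : ℤ} (x : X.X n) : disk R n ⟶ X :=
  (diskCorepresentable n).homEquiv.symm x

lemma homEquiv_disk {X : ChainComplex (ModuleCat.{u} R) ℤ} {n : ℤ} (f : disk R n ⟶ X) :
    (diskCorepresentable n).homEquiv f = f.f n (diskGen R n) :=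
  (diskCorepresentable n).homEquiv_eq f

@[simp]
lemma diskHom_gen {X : ChainComplex (ModuleCat.{u} R) ℤ} {n : ℤ} (x : X.X n) :
    (diskHom x).f n (diskGen R n) = x := by
  rw [← homEquiv_disk]
  exact (diskCorepresentable n).homEquiv.apply_symm_apply x

lemma disk_hom_ext {X : ChainComplex (ModuleCat.{u} R) ℤ} {n : ℤ} {f g : disk R n ⟶ X}
    (h : f.f n (diskGen R n) = g.f n (diskGen R n)) : f = g := by
  refine (diskCorepresentable n).homEquiv.injective ?_
  rw [homEquiv_disk, homEquiv_disk, h]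

/-- Morphisms out of the disk are elements of degree n, and taking these commutes with filtered
colimits. -/
instance isFinitelyPresentable_disk (n : ℤ) : IsFinitelyPresentable.{u} (disk R n) := by
  rw [isFinitelyPresentable_iff_preservesFilteredColimits]
  refine ⟨fun J _ _ => ?_⟩
  exact preservesColimitsOfShape_of_natIso (diskCorepresentable (R := R) n).toIso.symm

variable {G : ℤ → Type u} (Y : Set (Σ q, G q)) (T : Set (Relation R G))

variable (R) in
/-- The free complex on a family of generators. -/
def freeComplex : ChainComplex (ModuleCat.{u} R) ℤ := ∐ fun y : Y => disk R y.1.1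

open Classical in
variable (R) in
/-- The generators in `Y` of the free complex, extended by zero. -/
def freeGen (y : Σ q, G q) : (freeComplex R Y).X y.1 :=
  if h : y ∈ Y then (Sigma.ι (fun y : Y => disk R y.1.1) ⟨y, h⟩).f y.1 (diskGen R y.1) else 0

variable {Y} in
lemma freeGen_of_mem {y : Σ q, G q} (h : y ∈ Y) :
    freeGen R Y y = (Sigma.ι (fun y : Y => disk R y.1.1) ⟨y, h⟩).f y.1 (diskGen R y.1) :=
  dif_pos h

/-- The complex given by the generators `Y` and the relations `T`. -/
def presented : ChainComplex (ModuleCat.{u} R) ℤ :=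
  cokernel (Sigma.desc fun ρ : T => diskHom (ρ.1.eval (freeComplex R Y) (freeGen R Y)))

/-- The generators of the complex given by generators and relations. -/
def presentedGen (y : Σ q, G q) : (presented Y T).X y.1 :=
  (cokernel.π (Sigma.desc fun ρ : T => diskHom (ρ.1.eval (freeComplex R Y) (freeGen R Y)))).f y.1
    (freeGen R Y y)

variable {Y T}

lemma eval_presentedGen {ρ : Relation R G} (hρ : ρ ∈ T) :
    ρ.eval (presented Y T) (presentedGen Y T) = 0 := by
  let r := Sigma.desc fun ρ : T => diskHom (ρ.1.eval (freeComplex R Y) (freeGen R Y))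
  have h : diskHom (ρ.eval (freeComplex R Y) (freeGen R Y)) ≫ cokernel.π r = 0 := by
    have : diskHom (ρ.eval (freeComplex R Y) (freeGen R Y)) =
        Sigma.ι (fun ρ : T => disk R ρ.1.deg) ⟨ρ, hρ⟩ ≫ r :=
      (Sigma.ι_desc (fun ρ : T => diskHom (ρ.1.eval (freeComplex R Y) (freeGen R Y)))
        ⟨ρ, hρ⟩).symm
    rw [this, Category.assoc, cokernel.condition, comp_zero]
  have h' := ConcreteCategory.congr_hom (HomologicalComplex.congr_hom h ρ.deg) (diskGen R ρ.deg)
  rw [HomologicalComplex.comp_f, ConcreteCategory.comp_apply, diskHom_gen, Relation.map_eval] at h'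
  exact h'

lemma presented_hom_ext {X : ChainComplex (ModuleCat.{u} R) ℤ} {f g : presented Y T ⟶ X}
    (h : ∀ y ∈ Y, f.f y.1 (presentedGen Y T y) = g.f y.1 (presentedGen Y T y)) : f = g := by
  refine coequalizer.hom_ext (Sigma.hom_ext _ _ fun y => disk_hom_ext ?_)
  have := h y.1 y.2
  simp only [presentedGen, freeGen_of_mem y.2] at this
  exact this

/-- Generators outside `Y` are zero in the presented complex, so the relations must not mention
them. -/
lemma presented_exists_desc {X : ChainComplex (ModuleCat.{u} R) ℤ} (s : ∀ y : (Σ q, G q), X.X y.1)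
    (hs : ∀ ρ ∈ T, ρ.eval X s = 0) (hT : ∀ ρ ∈ T, ρ.support ⊆ Y) :
    ∃ f : presented Y T ⟶ X, ∀ y ∈ Y, f.f y.1 (presentedGen Y T y) = s y := by
  let φ : freeComplex R Y ⟶ X := Sigma.desc fun y => diskHom (s y.1)
  have hφ (y) (hy : y ∈ Y) : φ.f y.1 (freeGen R Y y) = s y := by
    rw [freeGen_of_mem hy]
    have : Sigma.ι (fun y : Y => disk R y.1.1) ⟨y, hy⟩ ≫ φ = diskHom (s y) :=
      Sigma.ι_desc _ _
    have := ConcreteCategory.congr_hom (HomologicalComplex.congr_hom this y.1) (diskGen R y.1)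
    rw [diskHom_gen] at this
    exact this
  refine ⟨cokernel.desc _ φ (Sigma.hom_ext _ _ fun ρ => disk_hom_ext ?_), fun y hy => ?_⟩
  · rw [Sigma.ι_desc_assoc, comp_zero, HomologicalComplex.comp_f, ConcreteCategory.comp_apply,
      diskHom_gen, Relation.map_eval, Relation.eval_congr ρ.1 fun y hy => hφ y (hT _ ρ.2 hy),
      hs _ ρ.2]
    rfl
  · rw [← hφ y hy]
    exact ConcreteCategory.congr_hom (HomologicalComplex.congr_hom (cokernel.π_desc _ φ _) y.1) _

attribute [local instance] Cardinal.fact_isRegular_aleph0 in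
-- A finite colimit of disks: a cokernel of a map between finite coproducts of them.
lemma isFinitelyPresentable_presented [Finite Y] [Finite T] :
    IsFinitelyPresentable.{u} (presented Y T) := by
  have h (ι : Type u) [Finite ι] (n : ι → ℤ) :
      IsFinitelyPresentable.{u} (∐ fun i => disk R (n i)) := by
    have (k : Discrete ι) : IsCardinalPresentable.{u}
        ((Discrete.functor fun i => disk R (n i)).obj k) Cardinal.aleph0 :=
      isFinitelyPresentable_disk _
    refine isCardinalPresentable_of_isColimit _ (colimit.isColimit
      (Discrete.functor fun i => disk R (n i))) _ ?_
    rw [hasCardinalLT_aleph0_iff]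
    infer_instance
  have h₁ := h T fun ρ => ρ.1.deg
  have h₂ := h Y fun y => y.1.1
  have (k : WalkingParallelPair) : IsCardinalPresentable.{u} ((parallelPair
      (Sigma.desc fun ρ : T => diskHom (ρ.1.eval (freeComplex R Y) (freeGen R Y))) 0).obj k)
      Cardinal.aleph0 := by
    cases k
    · exact h₁
    · exact h₂
  refine isCardinalPresentable_of_isColimit _ (colimit.isColimit (parallelPair
    (Sigma.desc fun ρ : T => diskHom (ρ.1.eval (freeComplex R Y) (freeGen R Y))) 0)) _ ?_
  rw [hasCardinalLT_aleph0_iff]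
  infer_instance

end

/-! ### A complex as a filtered colimit of finitely related complexes -/

section

variable {R : Type u} [Ring R]

section

variable {G : ℤ → Type u} {Y : Set (Σ q, G q)} {T : Set (Relation R G)}
  {X : ChainComplex (ModuleCat.{u} R) ℤ}

/-- The morphism from a complex given by generators and relations determined by elements that
satisfy the relations. -/
def presentedDesc (s : ∀ y : (Σ q, G q), X.X y.1) (hs : ∀ ρ ∈ T, ρ.eval X s = 0)
    (hT : ∀ ρ ∈ T, ρ.support ⊆ Y) : presented Y T ⟶ X :=
  (presented_exists_desc s hs hT).choose

lemma presentedDesc_gen (s : ∀ y : (Σ q, G q), X.X y.1) (hs : ∀ ρ ∈ T, ρ.eval X s = 0)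
    (hT : ∀ ρ ∈ T, ρ.support ⊆ Y) {y : Σ q, G q} (hy : y ∈ Y) :
    (presentedDesc s hs hT).f y.1 (presentedGen Y T y) = s y :=
  (presented_exists_desc s hs hT).choose_spec y hy

end

variable (F : ChainComplex (ModuleCat.{u} R) ℤ)

variable {F} in
/-- The set of relations underlying a finite set of relations that hold in `F`. -/
abbrev relationSet (T : Finset (TrueRelation F)) : Set (Relation R fun q => F.X q) :=
  Subtype.val '' (T : Set (TrueRelation F))

variable {F} in
lemma forall_mem_relationSet {T : Finset (TrueRelation F)}
    {P : Relation R (fun q => F.X q) → Prop} (h : ∀ ρ ∈ T, P ρ.1) : ∀ ρ ∈ relationSet T, P ρ :=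
  Set.forall_mem_image.2 h

variable {F} in
/-- The complex generated by all homogeneous elements of `F` subject to finitely many of the
relations that hold in `F`. -/
abbrev finitelyRelatedObj (T : Finset (TrueRelation F)) : ChainComplex (ModuleCat.{u} R) ℤ :=
  -- All generators are kept, so the index set is just the directed set of finite sets of relations.
  -- These complexes need not be finitely presented, which is harmless.
  presented Set.univ (relationSet T)

variable {F} in
/-- The generators of the finitely related complexes. -/
abbrev finitelyRelatedGen (T : Finset (TrueRelation F)) (y : Σ q, F.X q) :
    (finitelyRelatedObj T).X y.1 :=
  presentedGen Set.univ (relationSet T) y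

variable {F} in
/-- The morphism from a finitely related complex determined by elements that satisfy the
relations. -/
abbrev finitelyRelatedHom {X : ChainComplex (ModuleCat.{u} R) ℤ} (T : Finset (TrueRelation F))
    (s : ∀ y : (Σ q, F.X q), X.X y.1) (hs : ∀ ρ ∈ T, ρ.1.eval X s = 0) :
    finitelyRelatedObj T ⟶ X :=
  presentedDesc s (forall_mem_relationSet hs) fun _ _ => Set.subset_univ _

variable {F} in
lemma finitelyRelatedHom_gen {X : ChainComplex (ModuleCat.{u} R) ℤ} (T : Finset (TrueRelation F))
    (s : ∀ y : (Σ q, F.X q), X.X y.1) (hs : ∀ ρ ∈ T, ρ.1.eval X s = 0) (y : Σ q, F.X q) :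
    (finitelyRelatedHom T s hs).f y.1 (finitelyRelatedGen T y) = s y :=
  presentedDesc_gen _ _ _ (Set.mem_univ y)

variable {F} in
lemma finitelyRelated_hom_ext {X : ChainComplex (ModuleCat.{u} R) ℤ} {T : Finset (TrueRelation F)}
    {f g : finitelyRelatedObj T ⟶ X}
    (h : ∀ y, f.f y.1 (finitelyRelatedGen T y) = g.f y.1 (finitelyRelatedGen T y)) : f = g :=
  presented_hom_ext fun y _ => h y

variable {F} in
/-- The transition morphisms between the finitely related complexes. -/
abbrev finitelyRelatedMap {T T' : Finset (TrueRelation F)} (h : T ≤ T') :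
    finitelyRelatedObj T ⟶ finitelyRelatedObj T' :=
  finitelyRelatedHom T (finitelyRelatedGen T') fun ρ hρ => eval_presentedGen ⟨ρ, h hρ, rfl⟩

/-- The canonical morphism from a finitely related complex. -/
abbrev finitelyRelatedTo (T : Finset (TrueRelation F)) : finitelyRelatedObj T ⟶ F :=
  finitelyRelatedHom T (fun y => y.2) fun ρ _ => ρ.2

lemma finitelyRelatedTo_gen (T : Finset (TrueRelation F)) (y : Σ q, F.X q) :
    (finitelyRelatedTo F T).f y.1 (finitelyRelatedGen T y) = y.2 :=
  finitelyRelatedHom_gen ..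

lemma finitelyRelatedMap_comp_to {T T' : Finset (TrueRelation F)} (h : T ≤ T') :
    finitelyRelatedMap h ≫ finitelyRelatedTo F T' = finitelyRelatedTo F T :=
  finitelyRelated_hom_ext fun y => by
    rw [HomologicalComplex.comp_f, ConcreteCategory.comp_apply, finitelyRelatedHom_gen,
      finitelyRelatedHom_gen, finitelyRelatedHom_gen]

/-- The diagram of the finitely related complexes. -/
def finitelyRelated : Finset (TrueRelation F) ⥤ ChainComplex (ModuleCat.{u} R) ℤ where
  obj T := finitelyRelatedObj T
  map h := finitelyRelatedMap (leOfHom h)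
  map_id _ := finitelyRelated_hom_ext fun _ => finitelyRelatedHom_gen ..
  map_comp _ _ := finitelyRelated_hom_ext fun _ => (finitelyRelatedHom_gen ..).trans
    ((congrArg _ (finitelyRelatedHom_gen ..)).trans (finitelyRelatedHom_gen ..)).symm

/-- The tautological cocone over the finitely related complexes. -/
def finitelyRelatedCocone : Cocone (finitelyRelated F) where
  pt := F
  ι :=
    { app T := finitelyRelatedTo F T
      naturality _ _ h := (finitelyRelatedMap_comp_to F (leOfHom h)).trans
        (Category.comp_id _).symm }

section

variable {F} (c : Cocone (finitelyRelated F))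

/-- The legs of a cocone over the finitely related complexes. -/
abbrev coconeLeg (T : Finset (TrueRelation F)) : finitelyRelatedObj T ⟶ c.pt := c.ι.app T

/-- The images of the generators under a cocone. -/
def coconeGen (y : Σ q, F.X q) : c.pt.X y.1 :=
  (coconeLeg c ∅).f y.1 (finitelyRelatedGen ∅ y)

lemma coconeLeg_gen (T : Finset (TrueRelation F)) (y : Σ q, F.X q) :
    (coconeLeg c T).f y.1 (finitelyRelatedGen T y) = coconeGen c y := by
  have h : finitelyRelatedMap (Finset.empty_subset T) ≫ coconeLeg c T = coconeLeg c ∅ :=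
    c.w (homOfLE (Finset.empty_subset T))
  rw [coconeGen, ← h, HomologicalComplex.comp_f, ConcreteCategory.comp_apply,
    finitelyRelatedHom_gen]

lemma eval_coconeGen (ρ : TrueRelation F) : ρ.1.eval c.pt (coconeGen c) = 0 := by
  have h : ρ.1.eval (finitelyRelatedObj {ρ}) (finitelyRelatedGen {ρ}) = 0 :=
    eval_presentedGen ⟨ρ, by simp, rfl⟩
  rw [← funext (coconeLeg_gen c {ρ}), ← Relation.map_eval (coconeLeg c {ρ}), h, map_zero]

/-- The morphism induced by a cocone over the finitely related complexes. -/
def finitelyRelatedDesc : F ⟶ c.pt where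
  f q := ModuleCat.ofHom
    { toFun y := coconeGen c ⟨q, y⟩
      map_add' y y' := ((Relation.eval_add_eq_zero_iff ..).1 (eval_coconeGen c
        ⟨.add q y y' (y + y'), (Relation.eval_add_eq_zero_iff ..).2 rfl⟩)).symm
      map_smul' r y := ((Relation.eval_smul_eq_zero_iff ..).1 (eval_coconeGen c
        ⟨.smul q r y (r • y), (Relation.eval_smul_eq_zero_iff ..).2 rfl⟩)).symm }
  comm' p q _ := by
    ext y
    exact (Relation.eval_d_eq_zero_iff ..).1 (eval_coconeGen c
      ⟨.d p q y (F.d p q y), (Relation.eval_d_eq_zero_iff ..).2 rfl⟩)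

end

/-- Every complex is the filtered colimit of finitely related complexes. -/
def finitelyRelatedIsColimit : IsColimit (finitelyRelatedCocone F) where
  desc c := finitelyRelatedDesc c
  fac c T := finitelyRelated_hom_ext fun y =>
    (congrArg ((finitelyRelatedDesc c).f y.1) (finitelyRelatedTo_gen F T y)).trans
      (coconeLeg_gen c T y).symm
  uniq c m hm := by
    ext q y
    have h := ConcreteCategory.congr_hom (HomologicalComplex.congr_hom (hm ∅) q)
      (finitelyRelatedGen ∅ ⟨q, y⟩)
    exact (congrArg (m.f q) (finitelyRelatedTo_gen F ∅ ⟨q, y⟩).symm).trans h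

end

/-! ### Purity -/

section

variable {R : Type u} [Ring R] {M F : ChainComplex (ModuleCat.{u} R) ℤ} {π : M ⟶ F}

/-- A map from a finitely presented A to the filtered colimit F factors through some stage T, and a
section of π that respects T maps this stage to M over F. -/
theorem LiftsFiniteRelations.exists_lift (h : LiftsFiniteRelations π)
    {A : ChainComplex (ModuleCat.{u} R) ℤ} (hA : IsFinitelyPresentable.{u} A) (f : A ⟶ F) :
    ∃ g : A ⟶ M, g ≫ π = f := by
  classical
  obtain ⟨T, p, hp⟩ := IsFinitelyPresentable.exists_hom_of_isColimit (finitelyRelatedIsColimit F) f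
  obtain ⟨s, hsπ, hs⟩ := h T
  have h : finitelyRelatedHom T s hs ≫ π = finitelyRelatedTo F T :=
    finitelyRelated_hom_ext fun y => (congrArg (π.f y.1) (finitelyRelatedHom_gen ..)).trans
      ((hsπ y).trans (finitelyRelatedHom_gen ..).symm)
  change A ⟶ finitelyRelatedObj T at p
  change p ≫ finitelyRelatedTo F T = f at hp
  exact ⟨p ≫ finitelyRelatedHom T s hs, by rw [Category.assoc, h, hp]⟩

theorem liftsFiniteRelations_of_exists_lift (hπ : ∀ i, Function.Surjective (π.f i))
    (h : ∀ A : ChainComplex (ModuleCat.{u} R) ℤ, IsFinitelyPresentable.{u} A →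
      ∀ f : A ⟶ F, ∃ g : A ⟶ M, g ≫ π = f) : LiftsFiniteRelations π := by
  classical
  intro T
  let Y : Set (Σ q, F.X q) := ⋃ ρ ∈ T, ρ.1.support
  have hY : Y.Finite := T.finite_toSet.biUnion fun ρ _ => ρ.1.finite_support
  have hTY : ∀ ρ ∈ relationSet T, ρ.support ⊆ Y := by
    rintro _ ⟨ρ, hρ, rfl⟩
    exact Set.subset_biUnion_of_mem (u := fun ρ : TrueRelation F => ρ.1.support) hρ
  have : Finite Y := hY
  have : Finite (relationSet T) := T.finite_toSet.image _
  obtain ⟨g, hg⟩ := h _ (isFinitelyPresentable_presented (Y := Y) (T := relationSet T))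
    (presentedDesc (fun y => y.2) (forall_mem_relationSet fun ρ _ => ρ.2) hTY)
  choose s₀ hs₀ using fun y : (Σ q, F.X q) => hπ y.1 y.2
  -- Generators that occur in no relation of `T` may be lifted arbitrarily.
  refine ⟨fun y => if y ∈ Y then g.f y.1 (presentedGen Y (relationSet T) y) else s₀ y,
    fun y => ?_, fun ρ hρ => ?_⟩
  · dsimp only
    split_ifs with hy
    · rw [← ConcreteCategory.comp_apply, ← HomologicalComplex.comp_f, hg,
        presentedDesc_gen _ _ _ hy]
    · exact hs₀ y
  · have hρ' : ρ.1 ∈ relationSet T := ⟨ρ, hρ, rfl⟩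
    rw [Relation.eval_congr ρ.1 (t := fun y => g.f y.1 (presentedGen Y (relationSet T) y))
      fun y hy => if_pos (hTY _ hρ' hy), ← Relation.map_eval, eval_presentedGen hρ', map_zero]

lemma surjective_of_epi [Epi π] (i : ℤ) : Function.Surjective (π.f i) :=
  (ModuleCat.epi_iff_surjective _).1 inferInstance

lemma IsPureEpi.surjective (h : IsPureEpi π) (i : ℤ) : Function.Surjective (π.f i) := by
  obtain ⟨K, ι, w, h⟩ := h
  have : Epi π := h.shortExact.epi_g
  exact surjective_of_epi i

lemma IsPureEpi.exists_lift (h : IsPureEpi π) {A : ChainComplex (ModuleCat.{u} R) ℤ}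
    (hA : IsFinitelyPresentable.{u} A) (f : A ⟶ F) : ∃ g : A ⟶ M, g ≫ π = f := by
  obtain ⟨K, ι, w, h⟩ := h
  have := (h.hom_shortExact A hA).epi_g
  exact (AddCommGrpCat.epi_iff_surjective _).1 this f

lemma shortExact_kernel (hπ : ∀ i, Function.Surjective (π.f i)) :
    (ShortComplex.mk (kernel.ι π) π (kernel.condition π)).ShortExact := by
  have (i : ℤ) : Epi (π.f i) := (ModuleCat.epi_iff_surjective _).2 (hπ i)
  have : Epi π := HomologicalComplex.epi_of_epi_f π this
  exact .mk (ShortComplex.exact_of_f_is_kernel _ (kernelIsKernel π))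

/-- Hom(A, -) is left exact, so only surjectivity on the right is at stake. -/
theorem isPureEpi_of_exists_lift (hπ : ∀ i, Function.Surjective (π.f i))
    (h : ∀ A : ChainComplex (ModuleCat.{u} R) ℤ, IsFinitelyPresentable.{u} A →
      ∀ f : A ⟶ F, ∃ g : A ⟶ M, g ≫ π = f) : IsPureEpi π := by
  refine ⟨kernel π, kernel.ι π, kernel.condition π, shortExact_kernel hπ, fun A hA => ?_⟩
  have : Mono ((preadditiveCoyoneda.obj (op A)).map (kernel.ι π)) :=
    (AddCommGrpCat.mono_iff_injective _).2 fun (a b : A ⟶ kernel π)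
      (hab : a ≫ kernel.ι π = b ≫ kernel.ι π) => (cancel_mono (kernel.ι π)).1 hab
  have : Epi ((preadditiveCoyoneda.obj (op A)).map π) :=
    (AddCommGrpCat.epi_iff_surjective _).2 fun f => h A hA f
  exact
    { exact := (ShortComplex.ab_exact_iff _).2 fun (f : A ⟶ M) (hf : f ≫ π = 0) =>
        ⟨kernel.lift π f hf, kernel.lift_ι π f hf⟩
      mono_f := ‹_›
      epi_g := ‹_› }

/-- A degreewise surjective morphism is a pure epimorphism if and only if it has a dual
retraction. -/
theorem isPureEpi_iff_hasDualRetraction (hπ : ∀ i, Function.Surjective (π.f i)) :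
    IsPureEpi π ↔ HasDualRetraction π :=
  ⟨fun h => (liftsFiniteRelations_of_exists_lift hπ fun _ hA => h.exists_lift hA).hasDualRetraction,
    fun h => isPureEpi_of_exists_lift hπ fun _ => (h.liftsFiniteRelations hπ).exists_lift⟩

theorem IsSemiFlat.isPureEpi (hF : IsSemiFlat F) (hπ : ∀ i, Function.Surjective (π.f i))
    (hq : QuasiIso π) : IsPureEpi π :=
  (isPureEpi_iff_hasDualRetraction hπ).2
    (hF.hasDualRetraction (shortExact_kernel hπ) ((shortExact_kernel hπ).acyclic_X₁ hq))

theorem IsSemiFree.isSemiFlat_of_isPureEpi (hM : IsSemiFree M) (hπ : IsPureEpi π) : IsSemiFlat F :=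
  hM.isSemiFlat_of_hasDualRetraction π ((isPureEpi_iff_hasDualRetraction hπ.surjective).1 hπ)

end

/-! ### Semi-free resolutions -/

section

variable {R : Type u} [Ring R]

/-- A morphism is a quasi-isomorphism if cycles lift along it with prescribed image. -/
lemma quasiIso_of_exists_lift {M F : ChainComplex (ModuleCat.{u} R) ℤ} {π : M ⟶ F}
    (hπ : ∀ i, Function.Surjective (π.f i))
    (h : ∀ i j k : ℤ, j + 1 = i → k + 1 = j → ∀ (z : M.X j) (y : F.X i), M.d j k z = 0 →
      F.d i j y = π.f j z → ∃ w : M.X i, M.d i j w = z ∧ π.f i w = y) : QuasiIso π := by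
  have hS := shortExact_kernel hπ
  have hd (i : ℤ) := hS.map_of_exact (HomologicalComplex.eval _ _ i)
  have hK : (kernel π).Acyclic := by
    rw [acyclic_iff_exact]
    intro i j k hi hk x hx
    have hz : π.f j ((kernel.ι π).f j x) = 0 :=
      ConcreteCategory.congr_hom (HomologicalComplex.congr_hom (kernel.condition π) j) x
    -- Prescribing the image 0 makes the lift `w` lie in the kernel, which is thus acyclic; the long
    -- exact sequence does the rest.
    obtain ⟨w, hw, hw'⟩ := h i j k hi hk ((kernel.ι π).f j x) 0
      (by rw [← hom_comm_apply, hx, map_zero]) (by rw [hz, map_zero])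
    obtain ⟨y, rfl⟩ := (ShortComplex.moduleCat_exact_iff _).1 (hd i).exact w hw'
    exact ⟨y, (hd j).moduleCat_injective_f ((hom_comm_apply (kernel.ι π) i j y).trans hw)⟩
  refine ⟨fun i => ?_⟩
  rw [quasiIsoAt_iff_isIso_homologyMap]
  have h₁ := (hK i).isZero_homology
  have h₂ := (hK (i - 1)).isZero_homology
  have : Mono (HomologicalComplex.homologyMap π i) :=
    (hS.homology_exact₂ i).mono_g (h₁.eq_of_src _ _)
  have : Epi (HomologicalComplex.homologyMap π i) :=
    (hS.homology_exact₃ i (i - 1) (by simp)).epi_f (h₂.eq_of_tgt _ _)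
  exact isIso_of_mono_of_epi _

end

/-- Cells of degree `i`, consisting of a value in `F_i` and a boundary that is a formal linear
combination of cells of degree `i - 1`. -/
inductive Cell {R : Type u} [Ring R] (F : ChainComplex (ModuleCat.{u} R) ℤ) : ℤ → Type u
  -- The boundary is recorded as a finite list of coefficients and cells, which makes the recursion
  -- well formed; that it is a cycle is imposed later by `IsGood`.
  | mk {i : ℤ} (y : F.X i) (n : ℕ) (r : Fin n → R) (c : Fin n → Cell F (i - 1)) : Cell F i

namespace Cell

variable {R : Type u} [Ring R] {F : ChainComplex (ModuleCat.{u} R) ℤ}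

/-- The value of a cell. -/
def val {i : ℤ} : Cell F i → F.X i
  | mk y _ _ _ => y

/-- The boundary of a cell. -/
def boundary {i : ℤ} : Cell F i → (Cell F (i - 1) →₀ R)
  | mk _ _ r c => ∑ k, Finsupp.single (c k) (r k)

/-- The height of a cell. -/
def level {i : ℤ} : Cell F i → ℕ
  -- The empty supremum is 0, so a cell with empty list has level 0, and every cell in the list has
  -- smaller level.
  | mk _ _ _ c => Finset.univ.sup fun k => (c k).level + 1

/-- The cells whose boundary is a cycle of cells of the same kind that maps to the boundary of the
value of the cell. -/
def IsGood {i : ℤ} : Cell F i → Prop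
  | mk y _ r c => (∀ k, (c k).IsGood) ∧ ∑ k, r k • (c k).boundary = 0 ∧
      F.d i (i - 1) y = ∑ k, r k • (c k).val

variable (F) in
/-- The basis of the semi-free resolution. -/
abbrev GoodCell (i : ℤ) : Type u := {c : Cell F i // c.IsGood}

/-- The boundary of a cell of the semi-free resolution. -/
def goodBoundary {i : ℤ} : GoodCell F i → (GoodCell F (i - 1) →₀ R)
  | ⟨mk _ _ r c, h⟩ => ∑ k, Finsupp.single ⟨c k, h.1 k⟩ (r k)

/-- The linear combination of cells underlying a linear combination of good cells. -/
def forgetGood (i : ℤ) : (GoodCell F i →₀ R) →ₗ[R] (Cell F i →₀ R) :=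
  Finsupp.lmapDomain R R Subtype.val

lemma forgetGood_injective (i : ℤ) : Function.Injective (forgetGood (F := F) i) :=
  Finsupp.mapDomain_injective Subtype.val_injective

lemma forgetGood_boundary {i : ℤ} (e : GoodCell F i) :
    forgetGood (i - 1) (goodBoundary e) = e.1.boundary := by
  obtain ⟨⟨y, n, r, c⟩, h⟩ := e
  change forgetGood _ (∑ k, Finsupp.single ⟨c k, h.1 k⟩ (r k)) = ∑ k, Finsupp.single (c k) (r k)
  rw [map_sum]
  exact Finset.sum_congr rfl fun k _ => Finsupp.mapDomain_single

variable (F) in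
/-- The differential of the semi-free resolution. -/
def differential (i : ℤ) : (GoodCell F i →₀ R) →ₗ[R] (GoodCell F (i - 1) →₀ R) :=
  Finsupp.linearCombination R goodBoundary

variable (F) in
/-- The augmentation of the semi-free resolution. -/
def augmentation (i : ℤ) : (GoodCell F i →₀ R) →ₗ[R] F.X i :=
  Finsupp.linearCombination R fun e => e.1.val

lemma differential_single {i : ℤ} (e : GoodCell F i) (r : R) :
    differential F i (Finsupp.single e r) = r • goodBoundary e :=
  Finsupp.linearCombination_single R r e

lemma augmentation_single {i : ℤ} (e : GoodCell F i) (r : R) :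
    augmentation F i (Finsupp.single e r) = r • e.1.val :=
  Finsupp.linearCombination_single R r e

lemma goodBoundary_mk {i : ℤ} {y : F.X i} {n : ℕ} {r : Fin n → R} {c : Fin n → Cell F (i - 1)}
    (h : (mk y n r c).IsGood) :
    goodBoundary ⟨mk y n r c, h⟩ = ∑ k, Finsupp.single ⟨c k, h.1 k⟩ (r k) := rfl

lemma differential_differential (i : ℤ) (z : GoodCell F i →₀ R) :
    differential F (i - 1) (differential F i z) = 0 := by
  have : (differential F (i - 1)).comp (differential F i) = 0 := by
    ext e : 2
    obtain ⟨⟨y, n, r, c⟩, h⟩ := e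
    -- The cycle condition in `IsGood` is an identity between combinations of all cells, hence is
    -- compared there.
    refine forgetGood_injective _ ?_
    change forgetGood _ (differential F (i - 1) (differential F i (Finsupp.single _ 1))) =
      forgetGood _ 0
    rw [differential_single, one_smul, goodBoundary_mk, map_sum, map_sum, map_zero]
    refine Eq.trans (Finset.sum_congr rfl fun k _ => ?_) h.2.1
    rw [differential_single, map_smul, forgetGood_boundary]
  exact LinearMap.congr_fun this z

lemma augmentation_differential (i : ℤ) (z : GoodCell F i →₀ R) :
    augmentation F (i - 1) (differential F i z) = F.d i (i - 1) (augmentation F i z) := by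
  have : (augmentation F (i - 1)).comp (differential F i) =
      (F.d i (i - 1)).hom.comp (augmentation F i) := by
    ext e : 2
    obtain ⟨⟨y, n, r, c⟩, h⟩ := e
    change augmentation F (i - 1) (differential F i (Finsupp.single _ 1)) =
      F.d i (i - 1) (augmentation F i (Finsupp.single _ 1))
    rw [differential_single, augmentation_single, one_smul, one_smul, goodBoundary_mk, map_sum]
    refine Eq.trans (Finset.sum_congr rfl fun k _ => ?_) h.2.2.symm
    rw [augmentation_single]
  exact LinearMap.congr_fun this z

/-- One cell is available for each cycle z and each y with ∂y equal to the image of z: list the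
support of z with its coefficients. This is what kills the homology of the kernel. -/
lemma exists_goodCell (i : ℤ) (z : GoodCell F (i - 1) →₀ R) (y : F.X i)
    (hz : differential F (i - 1) z = 0) (hy : F.d i (i - 1) y = augmentation F (i - 1) z) :
    ∃ e : GoodCell F i, goodBoundary e = z ∧ e.1.val = y := by
  let σ := z.support.equivFin.symm
  have hsum {M : Type u} [AddCommMonoid M] (f : GoodCell F (i - 1) → M) :
      ∑ k, f (σ k).1 = ∑ x ∈ z.support, f x :=
    (Equiv.sum_comp σ fun x => f x.1).trans (Finset.sum_coe_sort z.support f)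
  refine ⟨⟨mk y z.support.card (fun k => z (σ k).1) (fun k => (σ k).1.1),
    fun k => (σ k).1.2, ?_, ?_⟩, ?_, ?_⟩
  · have := congrArg (forgetGood _) hz
    rw [map_zero, differential, Finsupp.linearCombination_apply, Finsupp.sum, map_sum] at this
    rw [hsum fun x => z x • x.1.boundary, ← this]
    exact Finset.sum_congr rfl fun x _ => by rw [map_smul, forgetGood_boundary]
  · rw [hy, hsum fun x => z x • x.1.val]
    rfl
  · exact (hsum fun x => Finsupp.single x (z x)).trans z.sum_single
  · rfl

variable (F) in
/-- The semi-free resolution of a complex. -/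
def resolution : ChainComplex (ModuleCat.{u} R) ℤ where
  X i := ModuleCat.of R (GoodCell F i →₀ R)
  d i j := if h : i - 1 = j then
    ModuleCat.ofHom (differential F i) ≫ eqToHom (by rw [h]) else 0
  shape i j hij := dif_neg fun h => hij (by
    change j + 1 = i
    lia)
  d_comp_d' i j k hij hjk := by
    obtain rfl : i - 1 = j := by
      change j + 1 = i at hij
      lia
    obtain rfl : i - 1 - 1 = k := by
      change k + 1 = i - 1 at hjk
      lia
    rw [dif_pos rfl, dif_pos rfl]
    simp only [eqToHom_refl, Category.comp_id]
    exact ModuleCat.hom_ext (LinearMap.ext fun z => differential_differential i z)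

lemma resolution_d (i : ℤ) :
    (resolution F).d i (i - 1) = ModuleCat.ofHom (differential F i) :=
  (dif_pos rfl).trans (Category.comp_id _)

variable (F) in
/-- The semi-free resolution of a complex maps to the complex. -/
def resolutionTo : resolution F ⟶ F where
  f i := ModuleCat.ofHom (augmentation F i)
  comm' i j hij := by
    obtain rfl : i - 1 = j := by
      change j + 1 = i at hij
      lia
    rw [resolution_d]
    exact ModuleCat.hom_ext (LinearMap.ext fun z => (augmentation_differential i z).symm)

lemma resolution_isSemiFree : IsSemiFree (resolution F) := by
  refine ⟨fun i => GoodCell F i, fun i => Finsupp.basisSingleOne, fun i e => e.1.level,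
    fun i e => ?_⟩
  rw [resolution_d]
  obtain ⟨⟨y, n, r, c⟩, h⟩ := e
  change differential F i (Finsupp.single _ 1) ∈
    Submodule.span R ((fun e : GoodCell F (i - 1) => Finsupp.single e (1 : R)) '' _)
  rw [differential_single, one_smul, goodBoundary_mk]
  refine Submodule.sum_mem _ fun k _ => ?_
  rw [← mul_one (r k), ← smul_eq_mul, ← Finsupp.smul_single]
  refine Submodule.smul_mem _ _ (Submodule.subset_span ⟨⟨c k, h.1 k⟩, ?_, rfl⟩)
  change (c k).level < Finset.univ.sup fun k => (c k).level + 1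
  exact Nat.lt_of_succ_le (Finset.le_sup (f := fun k => (c k).level + 1) (Finset.mem_univ k))

lemma resolutionTo_exists_lift (i j k : ℤ) (hi : j + 1 = i) (hk : k + 1 = j)
    (z : (resolution F).X j) (y : F.X i) (hz : (resolution F).d j k z = 0)
    (hy : F.d i j y = (resolutionTo F).f j z) :
    ∃ w : (resolution F).X i, (resolution F).d i j w = z ∧ (resolutionTo F).f i w = y := by
  obtain rfl : i - 1 = j := by lia
  obtain rfl : i - 1 - 1 = k := by lia
  rw [resolution_d] at hz ⊢
  obtain ⟨e, he, hey⟩ := exists_goodCell i z y hz hy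
  refine ⟨(Finsupp.single e 1 : GoodCell F i →₀ R), ?_, ?_⟩
  · exact ((differential_single e 1).trans (one_smul R _)).trans he
  · exact ((augmentation_single e 1).trans (one_smul R _)).trans hey

/-- Two applications of the lifting property: the zero cycle yields a cycle z over ∂y, and then a
cell with boundary z and value y exists. -/
lemma resolutionTo_surjective (i : ℤ) : Function.Surjective ((resolutionTo F).f i) := by
  intro y
  -- a cycle of the resolution over the boundary of `y`
  obtain ⟨z, hz, hzy⟩ := resolutionTo_exists_lift (i - 1) (i - 1 - 1) (i - 1 - 1 - 1) (by lia)
    (by lia) 0 (F.d i (i - 1) y) (map_zero _) (by rw [d_d_apply, map_zero])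
  obtain ⟨w, -, hw⟩ := resolutionTo_exists_lift i (i - 1) (i - 1 - 1) (by lia) (by lia) z y hz
    hzy.symm
  exact ⟨w, hw⟩

lemma resolutionTo_quasiIso : QuasiIso (resolutionTo F) :=
  quasiIso_of_exists_lift resolutionTo_surjective resolutionTo_exists_lift

end Cell

end SemiFlat

end

theorem mainTheorem7 (R : Type u) [Ring R] (F : ChainComplex (ModuleCat.{u} R) ℤ) :
    List.TFAE
      [SemiFlat.IsSemiFlat F,
        ∀ (M : ChainComplex (ModuleCat.{u} R) ℤ) (α : M ⟶ F),
          (∀ i : ℤ, Function.Surjective (α.f i)) → QuasiIso α → SemiFlat.IsPureEpi α,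
        ∃ (L : ChainComplex (ModuleCat.{u} R) ℤ) (π : L ⟶ F),
          SemiFlat.IsSemiFree L ∧ QuasiIso π ∧ SemiFlat.IsPureEpi π] := by
  tfae_have 1 → 2 := fun h M α => h.isPureEpi
  tfae_have 2 → 3 := fun h => ⟨_, _, SemiFlat.Cell.resolution_isSemiFree,
    SemiFlat.Cell.resolutionTo_quasiIso,
    h _ (SemiFlat.Cell.resolutionTo F) SemiFlat.Cell.resolutionTo_surjective
      SemiFlat.Cell.resolutionTo_quasiIso⟩
  tfae_have 3 → 1 := fun ⟨L, π, hL, _, hπ⟩ => hL.isSemiFlat_of_isPureEpi hπ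
  tfae_finish
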